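/- Let $I$ be a closed two-sided ideal of a C*-algebra $A$, and let $H$ and $E$ be Hilbert C*-modules over $A$ that are countably generated, i.e. each has a countable subset whose $A$-linear span is dense. (Modules act on one fixed side throughout; right modules over $A$ are the same as left modules over the opposite algebra $A^{\mathrm{op}}$, and the formal text writes the algebra on the left.) Let $HI$ denote the closed submodule of $H$ spanned by the products of elements of $H$ with elements of $I$, and similarly $EI$; the quotients $H/HI$ and $E/EI$ are Hilbert C*-modules over $A/I$, with inner product $\langle x+HI,\,y+HI\rangle=\langle x,y\rangle+I$. An isomorphism of Hilbert C*-modules is a bijective module map that preserves the inner products. Let $\phi\colon H/HI\to E/EI$ be an isomorphism of Hilbert C*-modules over $A/I$. Then there is an isomorphism of Hilbert C*-modules over $A$ $$\Phi\colon H\oplus EI\to E\oplus HI$$ that lifts $\phi$, i.e. for $h\in H$ and $y\in EI$ the class modulo $EI$ of the first component of $\Phi(h,y)$ is $\phi(h+HI)$. Moreover, $\Phi$ can be chosen as follows: there is an adjointable operator $\psi\colon H\to E$ with $\|\psi\|\le 1$ that lifts $\phi$, i.e. $\psi(h)+EI=\phi(h+HI)$ for all $h\in H$, such that $$U=\begin{pmatrix}\psi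 & -\sqrt{1-\psi\psi^*}\\ \sqrt{1-\psi^*\psi} & \psi^*\end{pmatrix}\colon H\oplus E\to E\oplus H$$ is an isomorphism of Hilbert C*-modules and $\Phi$ is the restriction of $U$ to $H\oplus EI$. -/

import Mathlib

set_option linter.unusedSectionVars false

noncomputable section

namespace HilbertModule

open WithCStarModule

/-! Hilbert C⋆-modules are Mathlib's `CStarModule A E`, with `E` complete.  There the algebra `A` is
written on the left, `⟪x, a • y⟫ = a * ⟪x, y⟫`; right modules over an algebra are the same as left
modules over the opposite algebra. -/

section Basic

variable {A : Type*} [NonUnitalCStarAlgebra A] [PartialOrder A] [StarOrderedRing A]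

/-- A closed two-sided ideal of a C⋆-algebra is self-adjoint. -/
theorem star_mem_of_mem (I : TwoSidedIdeal A) [hI : IsClosed (I : Set A)] {x : A} (hx : x ∈ I) :
    star x ∈ I := by
  set b : A := x * star x with hb
  have hbI : b ∈ I := I.mul_mem_right _ _ hx
  have hbs : IsSelfAdjoint b := IsSelfAdjoint.mul_star_self x
  rw [← SetLike.mem_coe, ← hI.closure_eq, Metric.mem_closure_iff]
  intro r hr
  obtain ⟨δ, hδ, hδr⟩ : ∃ δ : ℝ, 0 < δ ∧ δ < r ^ 2 :=
    ⟨r ^ 2 / 2, by positivity, half_lt_self (by positivity)⟩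
  have hpos : ∀ t : ℝ, 0 < t ^ 2 + δ ^ 2 := fun t => by positivity
  have hcg : Continuous fun t : ℝ => t / (t ^ 2 + δ ^ 2) :=
    continuous_id.div (by fun_prop) fun t => (hpos t).ne'
  set g : A := cfcₙ (fun t : ℝ => t / (t ^ 2 + δ ^ 2)) b with hg
  set f : A := cfcₙ (fun t : ℝ => t * (t / (t ^ 2 + δ ^ 2))) b with hf
  have hfg : f = b * g := by
    rw [hf, cfcₙ_mul (fun t : ℝ => t) (fun t : ℝ => t / (t ^ 2 + δ ^ 2)) b
      (by fun_prop) (by simp) hcg.continuousOn (by simp), cfcₙ_id' ℝ b]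
  have hfI : f ∈ I := hfg ▸ I.mul_mem_right _ _ hbI
  have hcf : Continuous fun t : ℝ => t * (t / (t ^ 2 + δ ^ 2)) := continuous_id.mul hcg
  have hfs : star f = f := (cfcₙ_predicate (p := IsSelfAdjoint) _ b).star_eq
  refine ⟨star x * f, I.mul_mem_left _ _ hfI, ?_⟩
  have hbf : b * f = cfcₙ (fun t : ℝ => t * (t * (t / (t ^ 2 + δ ^ 2)))) b := by
    rw [cfcₙ_mul (fun t : ℝ => t) (fun t : ℝ => t * (t / (t ^ 2 + δ ^ 2))) b
      (by fun_prop) (by simp) hcf.continuousOn (by simp), cfcₙ_id' ℝ b]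
  have hcbf : Continuous fun t : ℝ => t * (t * (t / (t ^ 2 + δ ^ 2))) := continuous_id.mul hcf
  have hd : b - b * f =
      cfcₙ (fun t : ℝ => t - t * (t * (t / (t ^ 2 + δ ^ 2)))) b := by
    rw [cfcₙ_sub (fun t : ℝ => t) (fun t : ℝ => t * (t * (t / (t ^ 2 + δ ^ 2)))) b
      (by fun_prop) (by simp) hcbf.continuousOn (by simp), cfcₙ_id' ℝ b, hbf]
  have hcd : Continuous fun t : ℝ => t - t * (t * (t / (t ^ 2 + δ ^ 2))) :=
    continuous_id.sub hcbf
  have hfd : f * (b - b * f) = cfcₙ (fun t : ℝ => (t * (t / (t ^ 2 + δ ^ 2))) *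
      (t - t * (t * (t / (t ^ 2 + δ ^ 2))))) b := by
    rw [hd, hf, cfcₙ_mul (fun t : ℝ => t * (t / (t ^ 2 + δ ^ 2)))
      (fun t : ℝ => t - t * (t * (t / (t ^ 2 + δ ^ 2)))) b
      hcf.continuousOn (by simp) hcd.continuousOn (by simp)]
  have key : star (star x - star x * f) * (star x - star x * f) =
      cfcₙ (fun t : ℝ => (t - t * (t * (t / (t ^ 2 + δ ^ 2)))) - (t * (t / (t ^ 2 + δ ^ 2))) *
      (t - t * (t * (t / (t ^ 2 + δ ^ 2))))) b := by
    rw [cfcₙ_sub (fun t : ℝ => t - t * (t * (t / (t ^ 2 + δ ^ 2))))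
      (fun t : ℝ => (t * (t / (t ^ 2 + δ ^ 2))) *
      (t - t * (t * (t / (t ^ 2 + δ ^ 2))))) b hcd.continuousOn (by simp)
      (hcf.mul hcd).continuousOn (by simp), ← hd, ← hfd]
    simp only [star_sub, star_mul, star_star, hfs, hb]
    noncomm_ring
  have hn : ‖star x - star x * f‖ * ‖star x - star x * f‖ ≤ δ := by
    rw [← CStarRing.norm_star_mul_self, key]
    refine norm_cfcₙ_le fun t _ => ?_
    have h0 := hpos t
    have : (t - t * (t * (t / (t ^ 2 + δ ^ 2)))) - (t * (t / (t ^ 2 + δ ^ 2))) *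
      (t - t * (t * (t / (t ^ 2 + δ ^ 2)))) = t * δ ^ 4 / (t ^ 2 + δ ^ 2) ^ 2 := by
      field_simp
      ring
    rw [this, Real.norm_eq_abs, abs_div, abs_of_pos (pow_pos h0 2), div_le_iff₀ (by positivity),
      abs_mul, abs_of_pos (pow_pos hδ 4)]
    have h1 : |t| * δ ≤ t ^ 2 + δ ^ 2 := by
      nlinarith [sq_nonneg (|t| - δ), sq_abs t, abs_nonneg t]
    have h2 : δ ^ 2 ≤ t ^ 2 + δ ^ 2 := by nlinarith [sq_nonneg t]
    have h3 : (|t| * δ) * δ ^ 2 ≤ (t ^ 2 + δ ^ 2) * (t ^ 2 + δ ^ 2) := by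
      gcongr
    nlinarith
  rw [dist_eq_norm]
  nlinarith [norm_nonneg (star x - star x * f)]

variable {E : Type*} [NormedAddCommGroup E] [NormedSpace ℂ E] [SMul A E] [CStarModule A E]

theorem ext_inner {x y : E} (h : ∀ z : E, inner A z x = inner A z y) : x = y := by
  rw [← sub_eq_zero, ← CStarModule.inner_self (A := A)]
  simp [CStarModule.inner_sub_right, h]

theorem alg_smul_add (a : A) (x y : E) : a • (x + y) = a • x + a • y :=
  ext_inner (A := A) fun z => by simp [mul_add]

theorem alg_smul_complex_smul (a : A) (c : ℂ) (x : E) : a • c • x = c • a • x :=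
  ext_inner (A := A) fun z => by simp [mul_smul_comm]

theorem alg_mul_smul (a b : A) (x : E) : (a * b) • x = a • b • x :=
  ext_inner (A := A) fun z => by simp [mul_assoc]

theorem alg_sub_smul (a b : A) (x : E) : (a - b) • x = a • x - b • x :=
  ext_inner (A := A) fun z => by simp [sub_mul]

theorem norm_alg_smul_le (a : A) (x : E) : ‖a • x‖ ≤ ‖a‖ * ‖x‖ := by
  refine le_of_sq_le_sq ?_ (by positivity)
  rw [CStarModule.norm_sq_eq A, mul_pow, CStarModule.norm_sq_eq A (x := x)]
  simp only [CStarModule.inner_op_smul_right, CStarModule.inner_op_smul_left]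
  calc ‖a * (inner A x x * star a)‖ ≤ ‖a‖ * (‖inner A x x‖ * ‖star a‖) :=
        (norm_mul_le _ _).trans (by gcongr; exact norm_mul_le _ _)
    _ = ‖a‖ ^ 2 * ‖inner A x x‖ := by rw [norm_star]; ring

variable (A E) in
/-- The action of `a : A` on a Hilbert module, as a bounded operator. -/
def algSMulCLM (a : A) : E →L[ℂ] E :=
  LinearMap.mkContinuous
    { toFun := fun x => a • x
      map_add' := alg_smul_add a
      map_smul' := fun c x => alg_smul_complex_smul a c x } ‖a‖ (norm_alg_smul_le a)

@[simp] theorem algSMulCLM_apply (a : A) (x : E) : algSMulCLM A E a x = a • x := rfl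

variable (A E) in
/-- `E` is countably generated: there is a countable set whose `A`-linear span is dense. -/
def IsCountablyGenerated : Prop :=
  ∃ s : Set E, s.Countable ∧
    Dense (Submodule.span ℂ {y : E | ∃ a : A, ∃ x ∈ s, y = a • x} : Set E)

variable (E) in
/-- The submodule of products of elements of `E` with elements of the ideal `I`
(denoted `EI` for right modules), i.e. the closed linear span of all such products. -/
def idealSubmodule (I : TwoSidedIdeal A) : Submodule ℂ E :=
  (Submodule.span ℂ {y : E | ∃ a ∈ I, ∃ x : E, y = a • x}).topologicalClosure

theorem isClosed_idealSubmodule (I : TwoSidedIdeal A) :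
    IsClosed (idealSubmodule E I : Set E) :=
  Submodule.isClosed_topologicalClosure _

theorem smul_mem_idealSubmodule {I : TwoSidedIdeal A} {a : A} (ha : a ∈ I) (x : E) :
    a • x ∈ idealSubmodule E I :=
  Submodule.le_topologicalClosure _ (Submodule.subset_span ⟨a, ha, x, rfl⟩)

/-- To map `idealSubmodule E I` into a closed subspace, it suffices to map the products there. -/
theorem map_mem_of_mem_idealSubmodule {I : TwoSidedIdeal A} {F : Type*} [NormedAddCommGroup F]
    [NormedSpace ℂ F] (T : E →L[ℂ] F) (p : AddSubgroup F) (hp : IsClosed (p : Set F))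
    (h : ∀ a ∈ I, ∀ x : E, T (a • x) ∈ p) {x : E} (hx : x ∈ idealSubmodule E I) : T x ∈ p := by
  have hsub : (Submodule.span ℂ {y : E | ∃ a ∈ I, ∃ x : E, y = a • x} : Set E) ⊆
      T ⁻¹' (p : Set F) := by
    intro y hy
    induction hy using Submodule.closure_induction with
    | zero => simp
    | add y z _ _ hy hz => simpa using add_mem hy hz
    | smul_mem c y hy =>
      obtain ⟨a, ha, x, rfl⟩ := hy
      rw [← alg_smul_complex_smul]
      exact h a ha _
  exact closure_minimal hsub (hp.preimage T.continuous) hx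

theorem smul_mem_idealSubmodule' (I : TwoSidedIdeal A) (a : A) {x : E}
    (hx : x ∈ idealSubmodule E I) : a • x ∈ idealSubmodule E I :=
  map_mem_of_mem_idealSubmodule (algSMulCLM A E a) (idealSubmodule E I).toAddSubgroup
    (isClosed_idealSubmodule I)
    (fun b hb y => by
      rw [algSMulCLM_apply, ← alg_mul_smul]
      exact smul_mem_idealSubmodule (I.mul_mem_left _ _ hb) y) hx

theorem inner_right_mem (I : TwoSidedIdeal A) [hI : IsClosed (I : Set A)] (x : E) {y : E}
    (hy : y ∈ idealSubmodule E I) : inner A x y ∈ I :=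
  map_mem_of_mem_idealSubmodule (CStarModule.innerSL (A := A) x)
    { carrier := I, zero_mem' := I.zero_mem, add_mem' := I.add_mem, neg_mem' := I.neg_mem } hI
    (fun a ha y => by
      simpa [CStarModule.innerSL_apply] using I.mul_mem_right _ _ ha) hy

theorem inner_left_mem (I : TwoSidedIdeal A) [IsClosed (I : Set A)] {x : E} (y : E)
    (hx : x ∈ idealSubmodule E I) : inner A x y ∈ I := by
  rw [← CStarModule.star_inner]
  exact star_mem_of_mem I (inner_right_mem I y hx)

/-! ### `EI` as a Hilbert `A`-module, with the operations of `E` -/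

instance (I : TwoSidedIdeal A) : SMul A (idealSubmodule E I) where
  smul a x := ⟨a • (x : E), smul_mem_idealSubmodule' I a x.2⟩

instance (I : TwoSidedIdeal A) : CStarModule A (idealSubmodule E I) where
  inner x y := inner A (x : E) (y : E)
  inner_add_right := by simp
  inner_self_nonneg := CStarModule.inner_self_nonneg
  inner_self {x} := by simp [CStarModule.inner_self]
  inner_op_smul_right {a x y} := CStarModule.inner_op_smul_right (x := (x : E)) (y := (y : E))
  inner_smul_right_complex := by simp
  star_inner x y := CStarModule.star_inner _ _
  norm_eq_sqrt_norm_inner_self x := CStarModule.norm_eq_sqrt_norm_inner_self (x : E)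

/-! ### `E/EI` as a Hilbert `A/I`-module -/

instance (I : TwoSidedIdeal A) : SMul I.ringCon.Quotient (E ⧸ idealSubmodule E I) where
  smul := Quotient.map₂ (fun (a : A) (x : E) => a • x) fun a b hab x y hxy => by
    have hab' : a - b ∈ I := (I.rel_iff a b).1 hab
    have hxy' : x - y ∈ idealSubmodule E I := (Submodule.quotientRel_def _).1 hxy
    refine (Submodule.quotientRel_def _).2 ?_
    have : a • x - b • y = (a - b) • x + b • (x - y) := by
      rw [alg_sub_smul, sub_eq_add_neg x y, alg_smul_add, ← neg_one_smul ℂ y,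
        alg_smul_complex_smul, neg_one_smul]
      abel
    rw [this]
    exact add_mem (smul_mem_idealSubmodule hab' x) (smul_mem_idealSubmodule' I b hxy')

theorem mk_smul_mk (I : TwoSidedIdeal A) (a : A) (x : E) :
    (a : I.ringCon.Quotient) • (Submodule.Quotient.mk x : E ⧸ idealSubmodule E I) =
      Submodule.Quotient.mk (a • x) := rfl

/-- The `A/I`-valued inner product of `E/EI`: `⟪x + EI, y + EI⟫ = ⟪x, y⟫ + I`. -/
instance (I : TwoSidedIdeal A) [IsClosed (I : Set A)] :
    Inner I.ringCon.Quotient (E ⧸ idealSubmodule E I) where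
  inner := Quotient.map₂ (fun (x y : E) => inner A x y) fun x x' hx y y' hy => by
    have hx' : x - x' ∈ idealSubmodule E I := (Submodule.quotientRel_def _).1 hx
    have hy' : y - y' ∈ idealSubmodule E I := (Submodule.quotientRel_def _).1 hy
    refine (I.rel_iff _ _).2 ?_
    have : inner A x y - inner A x' y' = inner A (x - x') y + inner A x' (y - y') := by
      simp
    rw [this]
    exact add_mem (inner_left_mem I y hx') (inner_right_mem I x' hy')

theorem inner_mk_mk (I : TwoSidedIdeal A) [IsClosed (I : Set A)] (x y : E) :
    inner I.ringCon.Quotient (Submodule.Quotient.mk x : E ⧸ idealSubmodule E I)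
      (Submodule.Quotient.mk y) = ((inner A x y : A) : I.ringCon.Quotient) := rfl

end Basic

/-- Isomorphisms (unitaries) of Hilbert modules over an algebra `B`: bijective linear maps that
respect the action of `B` and the `B`-valued inner products. -/
structure Iso (B X Y : Type*) [AddCommGroup X] [Module ℂ X] [SMul B X] [Inner B X]
    [AddCommGroup Y] [Module ℂ Y] [SMul B Y] [Inner B Y] extends X ≃ₗ[ℂ] Y where
  map_alg_smul' : ∀ (b : B) (x : X), toFun (b • x) = b • toFun x
  inner_map_map' : ∀ x y : X, inner B (toFun x) (toFun y) = inner B x y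

instance (B X Y : Type*) [AddCommGroup X] [Module ℂ X] [SMul B X] [Inner B X]
    [AddCommGroup Y] [Module ℂ Y] [SMul B Y] [Inner B Y] :
    CoeFun (Iso B X Y) fun _ => X → Y where
  coe f := f.toLinearEquiv

section Operators

variable (A : Type*) [NonUnitalCStarAlgebra A] [PartialOrder A] [StarOrderedRing A]
  {E : Type*} [NormedAddCommGroup E] [NormedSpace ℂ E] [SMul A E] [CStarModule A E]
  {F : Type*} [NormedAddCommGroup F] [NormedSpace ℂ F] [SMul A F] [CStarModule A F]

/-- `T : E → F` is adjointable with adjoint `S`. -/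
def IsAdjoint (T : E →L[ℂ] F) (S : F →L[ℂ] E) : Prop :=
  ∀ (x : E) (y : F), inner A (T x) y = inner A x (S y)

/-- `R` is the positive square root of `T` among the adjointable operators on `E`. -/
def IsPositiveSqrt (R T : E →L[ℂ] E) : Prop :=
  IsAdjoint A R R ∧ (∀ x : E, 0 ≤ inner A x (R x)) ∧ R ∘L R = T

end Operators

/-- The element `(x, y)` of the Hilbert module direct sum `E ⊕ F`. -/
def pair (A : Type*) {E F : Type*} (x : E) (y : F) : C⋆ᵐᵒᵈ(A, E × F) :=
  (WithCStarModule.equiv A (E × F)).symm (x, y)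

end HilbertModule

end

open HilbertModule WithCStarModule

noncomputable section

namespace HilbertModule

open Filter Topology CStarModule

section

variable {A : Type*} [NonUnitalCStarAlgebra A] [PartialOrder A] [StarOrderedRing A]
  {E : Type*} [NormedAddCommGroup E] [NormedSpace ℂ E] [SMul A E] [CStarModule A E]
  {F : Type*} [NormedAddCommGroup F] [NormedSpace ℂ F] [SMul A F] [CStarModule A F]
  {G : Type*} [NormedAddCommGroup G] [NormedSpace ℂ G] [SMul A G] [CStarModule A G]

/-! ### Adjointable operators -/

/-! The heart is an adjointable contraction ψ lifting φ; a Halmos dilation then gives U.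

Countable generation yields generating sequences `X` in H and `Y` in E with φ[X i] = [Y i], scaled
to be summable. Put p = ∑ ⟪X i, ·⟫ X i on H, q = ∑ ⟪Y i, ·⟫ Y i on E and G = ∑ ⟪X i, ·⟫ Y i from H
to E. Modulo I, φ carries p to q and G acts as φ p. With c_n = `cutoff n` and t r_k(t)² = c_{k+1}(t)
- c_k(t), r_k = `cutoffRoot k`, set ψ = ∑ r_k(q) G r_k(p). The n-th partial sum at x represents
φ[c_n(p) x] (`Iso.rel_liftSum`), and c_n(p) → 1 strongly because `X` generates
(`tendsto_cfc_cutoff`), so the limit lifts φ. Cauchy–Schwarz for G against p and q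
(`norm_sum_inner_gramOp_sq_le`) gives both strong convergence and ‖ψ‖ ≤ 1. Exchanging `X` and `Y`
gives the adjoint.

Let R = √(1 - ψ⋆ψ) and S = √(1 - ψψ⋆). Since ψR = Sψ, U is unitary. As φ preserves inner products,
⟪Rx, Rx⟫ = ⟪x, x⟫ - ⟪ψx, ψx⟫ lies in I, so R has range in HI; likewise S has range in EI. Hence U
and U⋆ restrict to mutually inverse maps between H ⊕ EI and E ⊕ HI. -/

theorem tendsto_inner {α : Type*} {l : Filter α} {f g : α → E} {x y : E}
    (hf : Tendsto f l (𝓝 x)) (hg : Tendsto g l (𝓝 y)) :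
    Tendsto (fun i => inner A (f i) (g i)) l (𝓝 (inner A x y)) :=
  (continuous_inner (A := A) (E := E)).continuousAt.tendsto.comp (hf.prodMk_nhds hg)

namespace IsAdjoint

variable {T T₁ T₂ : E →L[ℂ] F} {S S₁ S₂ : F →L[ℂ] E}

theorem symm (h : IsAdjoint A T S) : IsAdjoint A S T := fun x y => by
  rw [← star_inner, ← h y x, star_inner]

theorem add (h₁ : IsAdjoint A T₁ S₁) (h₂ : IsAdjoint A T₂ S₂) :
    IsAdjoint A (T₁ + T₂) (S₁ + S₂) := fun x y => by
  simp [h₁ x y, h₂ x y]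

theorem sub (h₁ : IsAdjoint A T₁ S₁) (h₂ : IsAdjoint A T₂ S₂) :
    IsAdjoint A (T₁ - T₂) (S₁ - S₂) := fun x y => by
  simp [h₁ x y, h₂ x y]

theorem smul (h : IsAdjoint A T S) (c : ℂ) : IsAdjoint A (c • T) (star c • S) := fun x y => by
  simp [h x y]

theorem comp {T' : F →L[ℂ] G} {S' : G →L[ℂ] F} (h' : IsAdjoint A T' S') (h : IsAdjoint A T S) :
    IsAdjoint A (T' ∘L T) (S ∘L S') := fun x y => by
  simp [h' (T x) y, h x (S' y)]

theorem sum {ι : Type*} (s : Finset ι) {T : ι → E →L[ℂ] F} {S : ι → F →L[ℂ] E}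
    (h : ∀ i ∈ s, IsAdjoint A (T i) (S i)) : IsAdjoint A (∑ i ∈ s, T i) (∑ i ∈ s, S i) :=
  fun x y => by
    simp only [_root_.sum_apply, inner_sum_left, inner_sum_right]
    exact Finset.sum_congr rfl fun i hi => h i hi x y

theorem id : IsAdjoint A (ContinuousLinearMap.id ℂ E) (ContinuousLinearMap.id ℂ E) :=
  fun _ _ => rfl

theorem unique (h₁ : IsAdjoint A T S₁) (h₂ : IsAdjoint A T S₂) : S₁ = S₂ := by
  ext y
  exact ext_inner (A := A) fun z => by rw [← h₁ z y, h₂ z y]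

theorem map_alg_smul (h : IsAdjoint A T S) (a : A) (x : E) : T (a • x) = a • T x :=
  ext_inner (A := A) fun z => by
    rw [inner_op_smul_right, ← h.symm, ← h.symm, inner_op_smul_right]

theorem norm_apply_sq_le (h : IsAdjoint A T S) (x : E) : ‖T x‖ ^ 2 ≤ ‖S (T x)‖ * ‖x‖ := by
  rw [norm_sq_eq A, h, mul_comm]
  exact norm_inner_le E

theorem norm_le (h : IsAdjoint A T S) : ‖T‖ ≤ ‖S‖ := by
  refine T.opNorm_le_bound (norm_nonneg _) fun x => ?_
  rcases (norm_nonneg (T x)).eq_or_lt with h0 | h0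
  · rw [← h0]; positivity
  · refine le_of_mul_le_mul_right ?_ h0
    calc ‖T x‖ * ‖T x‖ = ‖T x‖ ^ 2 := (sq _).symm
      _ ≤ ‖S (T x)‖ * ‖x‖ := h.norm_apply_sq_le x
      _ ≤ ‖S‖ * ‖T x‖ * ‖x‖ := by gcongr; exact S.le_opNorm _
      _ = ‖S‖ * ‖x‖ * ‖T x‖ := by ring

theorem norm_eq (h : IsAdjoint A T S) : ‖T‖ = ‖S‖ := le_antisymm h.norm_le h.symm.norm_le

theorem of_tendsto {α : Type*} {l : Filter α} [l.NeBot] {T' : α → E →L[ℂ] F} {S' : α → F →L[ℂ] E}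
    (h : ∀ i, IsAdjoint A (T' i) (S' i)) (hT : ∀ x, Tendsto (fun i => T' i x) l (𝓝 (T x)))
    (hS : ∀ y, Tendsto (fun i => S' i y) l (𝓝 (S y))) : IsAdjoint A T S := fun x y => by
  refine tendsto_nhds_unique (tendsto_inner (hT x) tendsto_const_nhds) ?_
  simp only [h _ x y]
  exact tendsto_inner tendsto_const_nhds (hS y)

end IsAdjoint

variable (A E) in
/-- The algebra of adjointable operators on `E`. -/
def adjointable : Subalgebra ℂ (E →L[ℂ] E) where
  carrier := {T | ∃ S, IsAdjoint A T S}
  mul_mem' := fun ⟨_, h₁⟩ ⟨_, h₂⟩ => ⟨_, h₁.comp h₂⟩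
  add_mem' := fun ⟨_, h₁⟩ ⟨_, h₂⟩ => ⟨_, h₁.add h₂⟩
  algebraMap_mem' c := ⟨star c • ContinuousLinearMap.id ℂ E, by
    rw [Algebra.algebraMap_eq_smul_one]
    exact IsAdjoint.id.smul c⟩

/-! ### The C⋆-algebra of adjointable operators -/

namespace adjointable

instance : Star (adjointable A E) where
  star a := ⟨a.2.choose, a, a.2.choose_spec.symm⟩

theorem isAdjoint_star (a : adjointable A E) :
    IsAdjoint A (a : E →L[ℂ] E) (star a : adjointable A E) :=
  a.2.choose_spec

theorem star_eq {a b : adjointable A E} (h : IsAdjoint A (a : E →L[ℂ] E) b) : star a = b :=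
  Subtype.ext ((isAdjoint_star a).unique h)

instance : StarRing (adjointable A E) where
  star_involutive a := star_eq (isAdjoint_star a).symm
  star_mul a b := star_eq ((isAdjoint_star a).comp (isAdjoint_star b))
  star_add a b := star_eq ((isAdjoint_star a).add (isAdjoint_star b))

instance : StarModule ℂ (adjointable A E) where
  star_smul c a := star_eq ((isAdjoint_star a).smul c)

instance : CStarRing (adjointable A E) where
  norm_mul_self_le a := by
    have h : ‖(a : E →L[ℂ] E)‖ ≤ √‖star a * a‖ := by
      refine ContinuousLinearMap.opNorm_le_bound _ (Real.sqrt_nonneg _) fun x => ?_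
      refine le_of_sq_le_sq ?_ (by positivity)
      rw [mul_pow, Real.sq_sqrt (norm_nonneg (star a * a))]
      calc ‖(a : E →L[ℂ] E) x‖ ^ 2 ≤ ‖(star a * a : adjointable A E).1 x‖ * ‖x‖ :=
            (isAdjoint_star a).norm_apply_sq_le x
        _ ≤ ‖star a * a‖ * ‖x‖ * ‖x‖ := by
            gcongr
            exact ContinuousLinearMap.le_opNorm _ _
        _ = ‖star a * a‖ * ‖x‖ ^ 2 := by ring
    calc ‖a‖ * ‖a‖ ≤ √‖star a * a‖ * √‖star a * a‖ := by gcongr <;> exact h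
      _ = ‖star a * a‖ := Real.mul_self_sqrt (norm_nonneg _)

variable [CompleteSpace E]

theorem isClosed : IsClosed (adjointable A E : Set (E →L[ℂ] E)) := by
  refine IsSeqClosed.isClosed fun T T₀ hT hlim => ?_
  choose S hS using hT
  have hcau : CauchySeq S := by
    refine Metric.cauchySeq_iff.2 fun ε hε => ?_
    obtain ⟨N, hN⟩ := Metric.cauchySeq_iff.1 hlim.cauchySeq ε hε
    refine ⟨N, fun m hm n hn => ?_⟩
    -- Passing to the adjoint is isometric, so the adjoints of a norm Cauchy sequence are again
    -- Cauchy.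
    rw [dist_eq_norm, ← ((hS m).sub (hS n)).norm_eq, ← dist_eq_norm]
    exact hN m hm n hn
  obtain ⟨S₀, hS₀⟩ := cauchySeq_tendsto_of_complete hcau
  exact ⟨S₀, .of_tendsto hS
    (fun x => ((ContinuousLinearMap.apply ℂ E x).continuous.tendsto _).comp hlim)
    (fun x => ((ContinuousLinearMap.apply ℂ E x).continuous.tendsto _).comp hS₀)⟩

instance : CompleteSpace (adjointable A E) := isClosed.completeSpace_coe

instance : CStarAlgebra (adjointable A E) where

/-- The adjointable operators carry the usual order of a C⋆-algebra. -/
instance : PartialOrder (adjointable A E) := CStarAlgebra.spectralOrder _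

instance : StarOrderedRing (adjointable A E) := CStarAlgebra.spectralOrderedRing _

theorem inner_nonneg {a : adjointable A E} (ha : 0 ≤ a) (x : E) :
    0 ≤ inner A x ((a : E →L[ℂ] E) x) := by
  obtain ⟨b, rfl⟩ := CStarAlgebra.nonneg_iff_eq_star_mul_self.1 ha
  have h : inner A x ((star b * b : adjointable A E).1 x) =
      inner A ((b : E →L[ℂ] E) x) ((b : E →L[ℂ] E) x) := (isAdjoint_star b x _).symm
  rw [h]
  exact inner_self_nonneg

theorem isAdjoint_self {a : adjointable A E} (ha : IsSelfAdjoint a) :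
    IsAdjoint A (a : E →L[ℂ] E) a := by
  simpa only [ha.star_eq] using isAdjoint_star a

theorem isSelfAdjoint_iff {a : adjointable A E} :
    IsSelfAdjoint a ↔ IsAdjoint A (a : E →L[ℂ] E) a :=
  ⟨isAdjoint_self, star_eq⟩

end adjointable

end

/-! ### Functional calculus for pairs of operators -/

section

/-- Star-homomorphisms commute with the functional calculus. Applied to the two projections of a
product, this transfers an intertwining relation from a pair of operators to continuous functions of
them. -/
theorem exists_mem_map_eq_cfc {B C D : Type*} [CStarAlgebra B] [CStarAlgebra C] [CStarAlgebra D]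
    (π₁ : D →⋆ₐ[ℂ] B) (π₂ : D →⋆ₐ[ℂ] C) (h₁ : Continuous π₁) (h₂ : Continuous π₂)
    (K : StarSubalgebra ℂ D) (hK : IsClosed (K : Set D))
    {f : ℝ → ℝ} (hf : Continuous f) {d : D} (hd : IsSelfAdjoint d) (h : d ∈ K) :
    ∃ d' ∈ K, π₁ d' = cfc f (π₁ d) ∧ π₂ d' = cfc f (π₂ d) :=
  ⟨cfc f d, cfc_mem (hs := hK) f h,
    StarAlgHomClass.map_cfc (R := ℝ) (S := ℂ) π₁ f d hf.continuousOn
      h₁ hd (hd.map π₁),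
    StarAlgHomClass.map_cfc (R := ℝ) (S := ℂ) π₂ f d hf.continuousOn
      h₂ hd (hd.map π₂)⟩

/-- A closed star-subalgebra of pairs is stable under the continuous functional calculus. -/
theorem cfc_prod_mem {B C : Type*} [CStarAlgebra B] [CStarAlgebra C] (K : StarSubalgebra ℂ (B × C))
    (hK : IsClosed (K : Set (B × C))) {f : ℝ → ℝ} (hf : Continuous f) {b : B} {c : C}
    (hb : IsSelfAdjoint b) (hc : IsSelfAdjoint c) (h : (b, c) ∈ K) : (cfc f b, cfc f c) ∈ K := by
  obtain ⟨d, hd, h₁, h₂⟩ := exists_mem_map_eq_cfc (D := B × C) (StarAlgHom.fst ℂ B C)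
    (StarAlgHom.snd ℂ B C) continuous_fst continuous_snd K hK hf (Prod.ext hb hc : IsSelfAdjoint (b, c)) h
  have : d = (cfc f b, cfc f c) := Prod.ext h₁ h₂
  exact this ▸ hd

end

section

variable {A : Type*} [NonUnitalCStarAlgebra A] [PartialOrder A] [StarOrderedRing A]
  {E : Type*} [NormedAddCommGroup E] [NormedSpace ℂ E] [SMul A E] [CStarModule A E]
  {H : Type*} [NormedAddCommGroup H] [NormedSpace ℂ H] [SMul A H] [CStarModule A H]

/-! ### Membership in `EI` and the graph of an isomorphism of quotients -/

/-- With b = ⟪x, x⟫ and f = b²/(b² + δ²), which lies in I because b does, f • x approximates x: ‖x -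
f • x‖² = ‖(1 - f) b (1 - f)‖, and |t| δ⁴/(t² + δ²)² ≤ δ. -/
theorem mem_idealSubmodule_of_inner_self_mem (I : TwoSidedIdeal A) {x : E}
    (hx : inner A x x ∈ I) : x ∈ idealSubmodule E I := by
  set b : A := inner A x x with hb
  have hbs : IsSelfAdjoint b := isSelfAdjoint_inner_self
  rw [← SetLike.mem_coe, ← (isClosed_idealSubmodule I).closure_eq, Metric.mem_closure_iff]
  intro r hr
  obtain ⟨δ, hδ, hδr⟩ : ∃ δ : ℝ, 0 < δ ∧ δ < r ^ 2 :=
    ⟨r ^ 2 / 2, by positivity, half_lt_self (by positivity)⟩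
  have hpos : ∀ t : ℝ, 0 < t ^ 2 + δ ^ 2 := fun t => by positivity
  have hcg : Continuous fun t : ℝ => t / (t ^ 2 + δ ^ 2) :=
    continuous_id.div (by fun_prop) fun t => (hpos t).ne'
  have hcf : Continuous fun t : ℝ => t * (t / (t ^ 2 + δ ^ 2)) := continuous_id.mul hcg
  set f : A := cfcₙ (fun t : ℝ => t * (t / (t ^ 2 + δ ^ 2))) b with hf
  have hfI : f ∈ I := by
    rw [hf, cfcₙ_mul (fun t : ℝ => t) (fun t : ℝ => t / (t ^ 2 + δ ^ 2)) b
      (by fun_prop) (by simp) hcg.continuousOn (by simp), cfcₙ_id' ℝ b]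
    exact I.mul_mem_right _ _ hx
  have hfs : star f = f := (cfcₙ_predicate (p := IsSelfAdjoint) _ b).star_eq
  have hd : b - f * b = cfcₙ (fun t : ℝ => t - t * (t / (t ^ 2 + δ ^ 2)) * t) b := by
    rw [cfcₙ_sub (fun t : ℝ => t) (fun t : ℝ => t * (t / (t ^ 2 + δ ^ 2)) * t) b
      (by fun_prop) (by simp) (hcf.mul continuous_id).continuousOn (by simp),
      cfcₙ_mul (fun t : ℝ => t * (t / (t ^ 2 + δ ^ 2))) (fun t : ℝ => t) b
      hcf.continuousOn (by simp) (by fun_prop) (by simp), cfcₙ_id' ℝ b]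
  have hcd : Continuous fun t : ℝ => t - t * (t / (t ^ 2 + δ ^ 2)) * t :=
    continuous_id.sub (hcf.mul continuous_id)
  have key : inner A (x - f • x) (x - f • x) =
      cfcₙ (fun t : ℝ => (t - t * (t / (t ^ 2 + δ ^ 2)) * t) -
        (t - t * (t / (t ^ 2 + δ ^ 2)) * t) * (t * (t / (t ^ 2 + δ ^ 2)))) b := by
    rw [cfcₙ_sub (fun t : ℝ => t - t * (t / (t ^ 2 + δ ^ 2)) * t)
      (fun t : ℝ => (t - t * (t / (t ^ 2 + δ ^ 2)) * t) * (t * (t / (t ^ 2 + δ ^ 2)))) b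
      hcd.continuousOn (by simp) (hcd.mul hcf).continuousOn (by simp),
      cfcₙ_mul (fun t : ℝ => t - t * (t / (t ^ 2 + δ ^ 2)) * t)
      (fun t : ℝ => t * (t / (t ^ 2 + δ ^ 2))) b
      hcd.continuousOn (by simp) hcf.continuousOn (by simp), ← hd, ← hf]
    simp only [CStarModule.inner_sub_left, CStarModule.inner_sub_right, inner_op_smul_left, inner_op_smul_right, hfs,
      ← hb]
    noncomm_ring
  refine ⟨f • x, smul_mem_idealSubmodule hfI x, ?_⟩
  have hn : ‖x - f • x‖ ^ 2 ≤ δ := by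
    rw [norm_sq_eq A, key]
    refine norm_cfcₙ_le fun t _ => ?_
    have h0 := hpos t
    have : (t - t * (t / (t ^ 2 + δ ^ 2)) * t) -
        (t - t * (t / (t ^ 2 + δ ^ 2)) * t) * (t * (t / (t ^ 2 + δ ^ 2))) =
        t * δ ^ 4 / (t ^ 2 + δ ^ 2) ^ 2 := by
      field_simp
      ring
    rw [this, Real.norm_eq_abs, abs_div, abs_of_pos (pow_pos h0 2), div_le_iff₀ (by positivity),
      abs_mul, abs_of_pos (pow_pos hδ 4)]
    have h1 : |t| * δ ≤ t ^ 2 + δ ^ 2 := by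
      nlinarith [sq_nonneg (|t| - δ), sq_abs t, abs_nonneg t]
    have h2 : δ ^ 2 ≤ t ^ 2 + δ ^ 2 := by nlinarith [sq_nonneg t]
    have h3 : (|t| * δ) * δ ^ 2 ≤ (t ^ 2 + δ ^ 2) * (t ^ 2 + δ ^ 2) := by
      gcongr
    nlinarith
  rw [dist_eq_norm]
  exact lt_of_pow_lt_pow_left₀ 2 hr.le (hn.trans_lt hδr)

variable {I : TwoSidedIdeal A} [hI : IsClosed (I : Set A)]

theorem mk_eq_mk_iff {x y : E} :
    (Submodule.Quotient.mk x : E ⧸ idealSubmodule E I) = Submodule.Quotient.mk y ↔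
      inner A (x - y) (x - y) ∈ I := by
  rw [Submodule.Quotient.eq]
  exact ⟨fun h => inner_right_mem I _ h, mem_idealSubmodule_of_inner_self_mem I⟩

/-- `φ` maps the class of `x` to the class of `y`. -/
def Iso.Rel (φ : Iso I.ringCon.Quotient (H ⧸ idealSubmodule H I) (E ⧸ idealSubmodule E I))
    (x : H) (y : E) : Prop :=
  (Submodule.Quotient.mk y : E ⧸ idealSubmodule E I) = φ (Submodule.Quotient.mk x)

namespace Iso.Rel

variable {φ : Iso I.ringCon.Quotient (H ⧸ idealSubmodule H I) (E ⧸ idealSubmodule E I)}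

theorem inner_sub_mem {x x' : H} {y y' : E} (h : φ.Rel x y) (h' : φ.Rel x' y') :
    inner A y y' - inner A x x' ∈ I := by
  have := φ.inner_map_map' (Submodule.Quotient.mk x) (Submodule.Quotient.mk x')
  change inner I.ringCon.Quotient (φ (Submodule.Quotient.mk x)) (φ (Submodule.Quotient.mk x')) =
    _ at this
  rw [← h, ← h', inner_mk_mk, inner_mk_mk] at this
  exact (I.rel_iff _ _).1 ((RingCon.eq _).1 this)

theorem exists_right (φ : Iso I.ringCon.Quotient (H ⧸ idealSubmodule H I)
    (E ⧸ idealSubmodule E I)) (x : H) : ∃ y, φ.Rel x y :=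
  Submodule.Quotient.mk_surjective _ _

theorem exists_left (φ : Iso I.ringCon.Quotient (H ⧸ idealSubmodule H I)
    (E ⧸ idealSubmodule E I)) (y : E) : ∃ x, φ.Rel x y := by
  obtain ⟨z, hz⟩ := φ.toLinearEquiv.surjective (Submodule.Quotient.mk y)
  obtain ⟨x, rfl⟩ := Submodule.Quotient.mk_surjective _ z
  exact ⟨x, hz.symm⟩

theorem zero : φ.Rel 0 0 := (map_zero φ.toLinearEquiv).symm

theorem add {x x' : H} {y y' : E} (h : φ.Rel x y) (h' : φ.Rel x' y') :
    φ.Rel (x + x') (y + y') := by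
  unfold Iso.Rel at *
  rw [Submodule.Quotient.mk_add, Submodule.Quotient.mk_add, h, h']
  exact (map_add φ.toLinearEquiv _ _).symm

theorem smul (c : ℂ) {x : H} {y : E} (h : φ.Rel x y) : φ.Rel (c • x) (c • y) := by
  unfold Iso.Rel at *
  rw [Submodule.Quotient.mk_smul, Submodule.Quotient.mk_smul, h]
  exact (map_smul φ.toLinearEquiv _ _).symm

theorem alg_smul {a b : A} (hab : a - b ∈ I) {x : H} {y : E} (h : φ.Rel x y) :
    φ.Rel (a • x) (b • y) := by
  have hab' : (a : I.ringCon.Quotient) = b := (RingCon.eq _).2 ((I.rel_iff _ _).2 hab)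
  unfold Iso.Rel at *
  rw [← mk_smul_mk, ← mk_smul_mk, h, hab']
  exact (φ.map_alg_smul' _ _).symm

theorem sum {ι : Type*} (s : Finset ι) {x : ι → H} {y : ι → E} (h : ∀ i, φ.Rel (x i) (y i)) :
    φ.Rel (∑ i ∈ s, x i) (∑ i ∈ s, y i) := by
  classical
  induction s using Finset.induction_on with
  | empty => simpa using zero
  | insert i s hi ih => simpa [Finset.sum_insert hi] using (h i).add ih

/-- If z represents φ[x], then pairing y and z with y - z and its partner w gives ⟪y - z, y - z⟫ ∈
I, so y - z lies in EI. Being related is thus a condition on inner products alone, which passes to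
adjoints and, as I is closed, to limits. -/
theorem of_inner {x : H} {y : E}
    (h : ∀ x' y', φ.Rel x' y' → inner A y y' - inner A x x' ∈ I) : φ.Rel x y := by
  obtain ⟨z, hz⟩ := exists_right φ x
  rw [Iso.Rel, ← (show _ = _ from hz), mk_eq_mk_iff]
  obtain ⟨w, hw⟩ := exists_left φ (y - z)
  have := sub_mem (h w _ hw) (hz.inner_sub_mem hw)
  simpa only [sub_sub_sub_cancel_right, ← CStarModule.inner_sub_left] using this

theorem of_tendsto {α : Type*} {l : Filter α} [l.NeBot] {f : α → H} {g : α → E} {x : H} {y : E}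
    (h : ∀ i, φ.Rel (f i) (g i)) (hf : Tendsto f l (𝓝 x)) (hg : Tendsto g l (𝓝 y)) :
    φ.Rel x y :=
  of_inner fun x' y' h' => hI.mem_of_tendsto
    ((tendsto_inner hg (tendsto_const_nhds (x := y'))).sub
      (tendsto_inner hf (tendsto_const_nhds (x := x'))))
    (Eventually.of_forall fun i => (h i).inner_sub_mem h')

end Iso.Rel

variable [CompleteSpace H] [CompleteSpace E]

/-- The pairs of adjointable operators on `H` and `E` that induce operators on `H/HI` and `E/EI`
intertwined by `φ`. -/
def Iso.intertwined
    (φ : Iso I.ringCon.Quotient (H ⧸ idealSubmodule H I) (E ⧸ idealSubmodule E I)) :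
    StarSubalgebra ℂ (adjointable A H × adjointable A E) where
  carrier := {T | ∀ x y, φ.Rel x y → φ.Rel (T.1.1 x) (T.2.1 y)}
  mul_mem' h₁ h₂ x y h := h₁ _ _ (h₂ _ _ h)
  add_mem' h₁ h₂ x y h := (h₁ _ _ h).add (h₂ _ _ h)
  algebraMap_mem' c x y h := by
    rw [Algebra.algebraMap_eq_smul_one]
    exact h.smul c
  -- Testing against a related pair (x', y') moves the star onto it, where `hT` applies.
  star_mem' {T} hT x y h := .of_inner fun x' y' h' => by
    have h₁ := (adjointable.isAdjoint_star T.1).symm x x'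
    have h₂ := (adjointable.isAdjoint_star T.2).symm y y'
    have := h.inner_sub_mem (hT _ _ h')
    rw [← h₁, ← h₂] at this
    exact this

theorem Iso.isClosed_intertwined
    (φ : Iso I.ringCon.Quotient (H ⧸ idealSubmodule H I) (E ⧸ idealSubmodule E I)) :
    IsClosed (φ.intertwined : Set (adjointable A H × adjointable A E)) := by
  refine IsSeqClosed.isClosed fun T T₀ hT hlim x y h => ?_
  refine .of_tendsto (fun n => hT n x y h) (l := atTop) ?_ ?_
  · exact (((ContinuousLinearMap.apply ℂ H x).continuous.comp
      (continuous_subtype_val.comp continuous_fst)).tendsto T₀).comp hlim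
  · exact (((ContinuousLinearMap.apply ℂ E y).continuous.comp
      (continuous_subtype_val.comp continuous_snd)).tendsto T₀).comp hlim

end

section

variable {A : Type*} [NonUnitalCStarAlgebra A] [PartialOrder A] [StarOrderedRing A]
  {E : Type*} [NormedAddCommGroup E] [NormedSpace ℂ E] [SMul A E] [CStarModule A E]
  {H : Type*} [NormedAddCommGroup H] [NormedSpace ℂ H] [SMul A H] [CStarModule A H]

/-! ### Sums of rank one operators -/

/-- This is Cauchy–Schwarz in the Hilbert module of finite families in A, where ⟪a, b⟫ = ∑ b i (a
i)⋆. -/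
theorem norm_sum_mul_star_sq_le {ι : Type*} (s : Finset ι) (a b : ι → A) :
    ‖∑ i ∈ s, b i * star (a i)‖ ^ 2 ≤
      ‖∑ i ∈ s, a i * star (a i)‖ * ‖∑ i ∈ s, b i * star (b i)‖ := by
  let x : C⋆ᵐᵒᵈ(A, s → A) := (equiv A (s → A)).symm fun i => a i
  let y : C⋆ᵐᵒᵈ(A, s → A) := (equiv A (s → A)).symm fun i => b i
  have h : ‖inner A x y‖ ≤ ‖x‖ * ‖y‖ := norm_inner_le _
  have h₂ := pow_le_pow_left₀ (norm_nonneg _) h 2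
  rw [mul_pow, pi_norm_sq, pi_norm_sq, pi_inner] at h₂
  simpa only [x, y, equiv_symm_pi_apply, inner_def,
    Finset.sum_coe_sort s fun i => b i * star (a i),
    Finset.sum_coe_sort s fun i => a i * star (a i),
    Finset.sum_coe_sort s fun i => b i * star (b i)] using h₂

theorem alg_add_smul (a b : A) (x : E) : (a + b) • x = a • x + b • x :=
  ext_inner (A := A) fun z => by simp [add_mul]

theorem complex_smul_alg_smul (c : ℂ) (a : A) (x : E) : (c • a) • x = c • a • x :=
  ext_inner (A := A) fun z => by simp [smul_mul_assoc]

variable (A) in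
/-- The operator `z ↦ ⟪x, z⟫ • y`. -/
def rankOne (x : H) (y : E) : H →L[ℂ] E :=
  LinearMap.mkContinuous
    { toFun := fun z => inner A x z • y
      map_add' := fun z w => by simp [alg_add_smul]
      map_smul' := fun c z => by simp [complex_smul_alg_smul] } (‖x‖ * ‖y‖) fun z => by
    calc ‖inner A x z • y‖ ≤ ‖inner A x z‖ * ‖y‖ := norm_alg_smul_le _ _
      _ ≤ ‖x‖ * ‖z‖ * ‖y‖ := by gcongr; exact norm_inner_le H
      _ = ‖x‖ * ‖y‖ * ‖z‖ := by ring

theorem rankOne_apply (x : H) (y : E) (z : H) : rankOne A x y z = inner A x z • y := rfl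

theorem norm_rankOne_le (x : H) (y : E) : ‖rankOne A x y‖ ≤ ‖x‖ * ‖y‖ :=
  LinearMap.mkContinuous_norm_le _ (by positivity) _

theorem isAdjoint_rankOne (x : H) (y : E) : IsAdjoint A (rankOne A x y) (rankOne A y x) :=
  fun z w => by simp [rankOne_apply]

variable (A) in
/-- The operator `z ↦ ∑ ⟪X i, z⟫ • Y i`. -/
def gramOp (X : ℕ → H) (Y : ℕ → E) : H →L[ℂ] E := ∑' i, rankOne A (X i) (Y i)

/-- A geometric bound that makes `gramOp` summable. -/
def GeomBounded (X : ℕ → H) : Prop := ∀ i, ‖X i‖ ≤ (1 / 2 : ℝ) ^ i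

variable {X : ℕ → H} {Y : ℕ → E}

section

variable [CompleteSpace E]

theorem hasSum_gramOp (hX : GeomBounded X) (hY : GeomBounded Y) :
    HasSum (fun i => rankOne A (X i) (Y i)) (gramOp A X Y) := by
  refine (Summable.of_norm_bounded (g := fun i => (1 / 2 : ℝ) ^ i) summable_geometric_two
    fun i => (norm_rankOne_le _ _).trans ?_).hasSum
  calc ‖X i‖ * ‖Y i‖ ≤ (1 / 2 : ℝ) ^ i * 1 := by
        gcongr
        · exact hX i
        · exact (hY i).trans (pow_le_one₀ (by norm_num) (by norm_num))
    _ = (1 / 2 : ℝ) ^ i := mul_one _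

theorem hasSum_gramOp_apply (hX : GeomBounded X) (hY : GeomBounded Y) (z : H) :
    HasSum (fun i => inner A (X i) z • Y i) (gramOp A X Y z) :=
  (hasSum_gramOp hX hY).mapL (ContinuousLinearMap.apply ℂ E z)

theorem hasSum_inner_gramOp (hX : GeomBounded X) (hY : GeomBounded Y) (x : H) (y : E) :
    HasSum (fun i => inner A (Y i) y * star (inner A (X i) x)) (inner A (gramOp A X Y x) y) := by
  have h := tendsto_inner (A := A) (hasSum_gramOp_apply (A := A) hX hY x)
    (tendsto_const_nhds (x := y))
  simpa [HasSum] using h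

variable [CompleteSpace H]

theorem isAdjoint_gramOp (hX : GeomBounded X) (hY : GeomBounded Y) :
    IsAdjoint A (gramOp A X Y) (gramOp A Y X) := by
  refine .of_tendsto (l := atTop) (fun s : Finset ℕ => IsAdjoint.sum s fun i _ =>
    isAdjoint_rankOne (X i) (Y i)) (fun x => ?_) fun y => ?_
  · simpa [HasSum, rankOne_apply] using hasSum_gramOp_apply (A := A) hX hY x
  · simpa [HasSum, rankOne_apply] using hasSum_gramOp_apply (A := A) hY hX y

/-- Cauchy–Schwarz over the pairs (i, k), for the families ⟪X i, u k⟫ and ⟪Y i, v k⟫. It holds for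
finitely many i and passes to the limit. -/
theorem norm_sum_inner_gramOp_sq_le (hX : GeomBounded X) (hY : GeomBounded Y) {κ : Type*}
    (s : Finset κ) (u : κ → H) (v : κ → E) :
    ‖∑ k ∈ s, inner A (gramOp A X Y (u k)) (v k)‖ ^ 2 ≤
      ‖∑ k ∈ s, inner A (gramOp A X X (u k)) (u k)‖ *
        ‖∑ k ∈ s, inner A (gramOp A Y Y (v k)) (v k)‖ := by
  have h₁ := hasSum_sum fun k (_ : k ∈ s) => hasSum_inner_gramOp (A := A) hX hY (u k) (v k)
  have h₂ := hasSum_sum fun k (_ : k ∈ s) => hasSum_inner_gramOp (A := A) hX hX (u k) (u k)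
  have h₃ := hasSum_sum fun k (_ : k ∈ s) => hasSum_inner_gramOp (A := A) hY hY (v k) (v k)
  refine le_of_tendsto_of_tendsto' (h₁.norm.pow 2) (h₂.norm.mul h₃.norm) fun t => ?_
  simp only [← Finset.sum_product']
  exact norm_sum_mul_star_sq_le _ (fun q : ℕ × κ => inner A (X q.1) (u q.2))
    fun q : ℕ × κ => inner A (Y q.1) (v q.2)

end

section

variable [CompleteSpace H]

/-- A term of the sum is dominated by the whole sum. -/
theorem inner_mul_star_le_inner_gramOp (hX : GeomBounded X) (i : ℕ) (z : H) :
    inner A (X i) z * star (inner A (X i) z) ≤ inner A (gramOp A X X z) z := by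
  have h := hasSum_inner_gramOp (A := A) hX hX z z
  refine ge_of_tendsto h ((eventually_ge_atTop {i}).mono fun t ht => ?_)
  exact Finset.single_le_sum (f := fun j => inner A (X j) z * star (inner A (X j) z))
    (fun j _ => mul_star_self_nonneg _) (ht (Finset.mem_singleton_self i))

/-- The positive compact operator `z ↦ ∑ ⟪X i, z⟫ • X i`. -/
def gramSelf (hX : GeomBounded X) : adjointable A H :=
  ⟨gramOp A X X, gramOp A X X, isAdjoint_gramOp hX hX⟩

theorem isSelfAdjoint_gramSelf (hX : GeomBounded X) :
    IsSelfAdjoint (gramSelf (A := A) hX) :=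
  adjointable.isSelfAdjoint_iff.2 (isAdjoint_gramOp hX hX)

end

/-! ### Gram operators modulo the ideal -/

section Rel

variable {I : TwoSidedIdeal A} [IsClosed (I : Set A)] [CompleteSpace H] [CompleteSpace E]
  {φ : Iso I.ringCon.Quotient (H ⧸ idealSubmodule H I) (E ⧸ idealSubmodule E I)}

theorem Iso.gramSelf_mem_intertwined (hX : GeomBounded X) (hY : GeomBounded Y)
    (h : ∀ i, φ.Rel (X i) (Y i)) :
    (gramSelf (A := A) hX, gramSelf (A := A) hY) ∈ φ.intertwined := fun x y hxy =>
  .of_tendsto (fun s => Iso.Rel.sum s fun i => (h i).alg_smul <| by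
      simpa using I.neg_mem ((h i).inner_sub_mem hxy))
    (hasSum_gramOp_apply (A := A) hX hX x) (hasSum_gramOp_apply (A := A) hY hY y)

/-- Both sums have the same coefficients ⟪X i, x⟫, on related vectors. -/
theorem Iso.Rel.gramOp_self (hX : GeomBounded X) (hY : GeomBounded Y)
    (h : ∀ i, φ.Rel (X i) (Y i)) (x : H) :
    φ.Rel (gramOp A X X x) (gramOp A X Y x) := by
  refine .of_tendsto (fun s => Iso.Rel.sum s fun i => (h i).alg_smul ?_)
    (hasSum_gramOp_apply (A := A) hX hX x) (hasSum_gramOp_apply (A := A) hX hY x)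
  rw [sub_self]
  exact I.zero_mem

end Rel

end

section

variable {A : Type*} [NonUnitalCStarAlgebra A] [PartialOrder A] [StarOrderedRing A]
  {E : Type*} [NormedAddCommGroup E] [NormedSpace ℂ E] [SMul A E] [CStarModule A E]
  {H : Type*} [NormedAddCommGroup H] [NormedSpace ℂ H] [SMul A H] [CStarModule A H]

/-! ### An approximate unit and a partition of it -/

/-- A bounded function that tends to `1` on `(0, ∞)` as `n → ∞`. -/
def cutoff (n : ℕ) (t : ℝ) : ℝ := n * t / (1 + n * |t|)

/-- The function with `t * cutoffRoot n t ^ 2 = cutoff (n + 1) t - cutoff n t`. -/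
def cutoffRoot (n : ℕ) (t : ℝ) : ℝ := (√((1 + n * |t|) * (1 + (n + 1) * |t|)))⁻¹

theorem continuous_cutoff (n : ℕ) : Continuous (cutoff n) :=
  Continuous.div (by fun_prop) (by fun_prop) fun t => by positivity

theorem continuous_cutoffRoot (n : ℕ) : Continuous (cutoffRoot n) :=
  Continuous.inv₀ (by fun_prop) fun t => by positivity

theorem cutoff_zero : cutoff 0 = 0 := by
  ext t
  simp [cutoff]

/-- The factors are ordered as in the operator product r(p) p r(p). The absolute values in the
denominators make the functions continuous on all of ℝ, so that self-adjointness of p suffices. -/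
theorem cutoffRoot_mul (n : ℕ) (t : ℝ) :
    cutoffRoot n t * (t * cutoffRoot n t) = cutoff (n + 1) t - cutoff n t := by
  have h₁ : 0 < 1 + n * |t| := by positivity
  have h₂ : 0 < 1 + (n + 1) * |t| := by positivity
  have : cutoffRoot n t * (t * cutoffRoot n t) =
      t * ((1 + n * |t|) * (1 + (n + 1) * |t|))⁻¹ := by
    rw [mul_left_comm, cutoffRoot, ← mul_inv, Real.mul_self_sqrt (by positivity)]
  rw [this, cutoff, cutoff]
  push_cast
  field_simp
  ring

theorem abs_cutoff_sub_le {m n : ℕ} (hmn : m ≤ n) (t : ℝ) : |cutoff n t - cutoff m t| ≤ 1 := by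
  have h₁ : 0 < 1 + n * |t| := by positivity
  have h₂ : 0 < 1 + m * |t| := by positivity
  have h₃ : (m : ℝ) ≤ n := by exact_mod_cast hmn
  have : cutoff n t - cutoff m t = (n - m) * t / ((1 + n * |t|) * (1 + m * |t|)) := by
    rw [cutoff, cutoff]
    field_simp
    ring
  rw [this, abs_div, abs_mul, abs_of_nonneg (sub_nonneg.2 h₃), abs_of_pos (mul_pos h₁ h₂)]
  refine div_le_one_of_le₀ ?_ (by positivity)
  have : 0 ≤ (m : ℝ) * |t| := by positivity
  nlinarith [mul_nonneg this h₁.le, abs_nonneg t]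

/-- For t ≥ 0 the left side is t/(1 + nt)², and nt ≤ (1 + nt)²; for t ≤ 0 it is not positive. -/
theorem one_sub_cutoff_mul_le {n : ℕ} (hn : 0 < n) (t : ℝ) :
    (1 - cutoff n t) * (t * (1 - cutoff n t)) ≤ 1 / n := by
  rcases le_total t 0 with ht | ht
  · have : (1 - cutoff n t) * (t * (1 - cutoff n t)) = t * (1 - cutoff n t) ^ 2 := by ring
    rw [this]
    exact (mul_nonpos_of_nonpos_of_nonneg ht (sq_nonneg _)).trans (by positivity)
  · have h₁ : 0 < 1 + n * t := by positivity
    have hn' : (0 : ℝ) < n := by exact_mod_cast hn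
    have : (1 - cutoff n t) * (t * (1 - cutoff n t)) = t / (1 + n * t) ^ 2 := by
      rw [cutoff, abs_of_nonneg ht]
      field_simp
      ring
    rw [this, div_le_div_iff₀ (by positivity) hn']
    nlinarith [mul_nonneg hn'.le ht]

section cfc

variable {B : Type*} [CStarAlgebra B] {p : B}

theorem cfc_cutoffRoot_mul (hp : IsSelfAdjoint p) (n : ℕ) :
    cfc (cutoffRoot n) p * (p * cfc (cutoffRoot n) p) =
      cfc (cutoff (n + 1)) p - cfc (cutoff n) p := by
  have hc := continuous_cutoffRoot n
  rw [← cfc_sub (cutoff (n + 1)) (cutoff n) p (continuous_cutoff _).continuousOn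
    (continuous_cutoff _).continuousOn]
  simp only [← cutoffRoot_mul]
  rw [cfc_mul (cutoffRoot n) (fun t => t * cutoffRoot n t) p hc.continuousOn
    (continuous_id.mul hc).continuousOn, cfc_mul (fun t => t) (cutoffRoot n) p
    continuous_id.continuousOn hc.continuousOn, cfc_id' ℝ p]

theorem norm_cfc_cutoff_sub_le {m n : ℕ} (hmn : m ≤ n) :
    ‖cfc (cutoff n) p - cfc (cutoff m) p‖ ≤ 1 := by
  rw [← cfc_sub (cutoff n) (cutoff m) p (continuous_cutoff _).continuousOn
    (continuous_cutoff _).continuousOn]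
  exact norm_cfc_le zero_le_one fun t _ => abs_cutoff_sub_le hmn t

theorem cfc_cutoff_zero : cfc (cutoff 0) p = 0 := by
  rw [cutoff_zero]
  exact cfc_zero ℝ p

theorem norm_cfc_cutoff_le (n : ℕ) : ‖cfc (cutoff n) p‖ ≤ 1 := by
  simpa [cfc_cutoff_zero] using norm_cfc_cutoff_sub_le (p := p) n.zero_le

theorem one_sub_cfc_cutoff_mul_le [PartialOrder B] [StarOrderedRing B] (hp : IsSelfAdjoint p)
    {n : ℕ} (hn : 0 < n) :
    (1 - cfc (cutoff n) p) * (p * (1 - cfc (cutoff n) p)) ≤ algebraMap ℝ B (1 / n) := by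
  have hc : Continuous fun t => 1 - cutoff n t := continuous_const.sub (continuous_cutoff n)
  have h : 1 - cfc (cutoff n) p = cfc (fun t => 1 - cutoff n t) p := by
    rw [cfc_sub (fun _ => 1) (cutoff n) p continuous_const.continuousOn
      (continuous_cutoff n).continuousOn, cfc_const_one ℝ p]
  have h' : (1 - cfc (cutoff n) p) * (p * (1 - cfc (cutoff n) p)) =
      cfc (fun t => (1 - cutoff n t) * (t * (1 - cutoff n t))) p := by
    rw [h, cfc_mul (fun t => 1 - cutoff n t) (fun t => t * (1 - cutoff n t)) p hc.continuousOn
      (continuous_id.mul hc).continuousOn, cfc_mul (fun t => t) (fun t => 1 - cutoff n t) p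
      continuous_id.continuousOn hc.continuousOn, cfc_id' ℝ p]
  rw [h']
  exact cfc_le_algebraMap _ _ _ (fun t _ => one_sub_cutoff_mul_le hn t)
    (hc.mul (continuous_id.mul hc)).continuousOn

end cfc

/-! ### Strong convergence of the approximate unit and of the lift -/

section Strict

variable [CompleteSpace H] [CompleteSpace E] {X : ℕ → H} {Y : ℕ → E}

variable (A) in
/-- The `A`-linear span of the sequence is dense. -/
def IsGenerating (X : ℕ → H) : Prop :=
  Dense (Submodule.span ℂ {y : H | ∃ a : A, ∃ i, y = a • X i} : Set H)

theorem isAdjoint_cfc (f : ℝ → ℝ) (p : adjointable A H) :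
    IsAdjoint A (cfc f p : adjointable A H).1 (cfc f p : adjointable A H).1 :=
  adjointable.isAdjoint_self (cfc_predicate f p)

theorem isAdjoint_one_sub_cfc (f : ℝ → ℝ) (p : adjointable A H) :
    IsAdjoint A (1 - cfc f p : adjointable A H).1 (1 - cfc f p : adjointable A H).1 :=
  adjointable.isAdjoint_self ((IsSelfAdjoint.one _).sub (cfc_predicate f p))

/-- Let e = 1 - c_n(p) and z = e (X i). Then ⟪X i, e z⟫ = ⟪z, z⟫, and a single term of the Gram sum
at e z is at most the whole: ⟪z, z⟫² ≤ ⟪z, e p e z⟫ ≤ ⟪z, z⟫/n. Taking norms gives ‖z‖⁴ ≤ ‖z‖²/n. -/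
theorem norm_sub_cfc_cutoff_sq_le (hX : GeomBounded X) {n : ℕ} (hn : 0 < n) (i : ℕ) :
    ‖X i - (cfc (cutoff n) (gramSelf (A := A) hX)).1 (X i)‖ ^ 2 ≤ 1 / n := by
  set p := gramSelf (A := A) hX with hp
  set e := 1 - cfc (cutoff n) p with he
  have hee : IsAdjoint A e.1 e.1 := isAdjoint_one_sub_cfc (cutoff n) p
  change ‖e.1 (X i)‖ ^ 2 ≤ 1 / n
  set z := e.1 (X i) with hz
  have h₁ := inner_mul_star_le_inner_gramOp (A := A) hX i (e.1 z)
  rw [← hee, ← hz, star_inner] at h₁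
  have h₂ : inner A (gramOp A X X (e.1 z)) (e.1 z) = inner A z ((e * (p * e)).1 z) := by
    rw [isAdjoint_gramOp hX hX, hee]
    rfl
  have h₃ := adjointable.inner_nonneg
    (sub_nonneg.2 (one_sub_cfc_cutoff_mul_le (isSelfAdjoint_gramSelf (A := A) hX) hn)) z
  have h₄ : (algebraMap ℝ (adjointable A H) (1 / n)).1 z = ((1 / n : ℝ) : ℂ) • z := rfl
  have h₅ : inner A z ((e * (p * e)).1 z) ≤ ((1 / n : ℝ) : ℂ) • inner A z z := by
    rw [← inner_smul_right_complex, ← h₄, ← sub_nonneg, ← CStarModule.inner_sub_right]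
    exact h₃
  have h₆ := CStarAlgebra.norm_le_norm_of_nonneg_of_le
    (by simpa using mul_star_self_nonneg (inner A z z)) (h₁.trans (h₂.trans_le h₅))
  have h₇ : ‖z‖ ^ 2 * ‖z‖ ^ 2 ≤ 1 / n * ‖z‖ ^ 2 := by
    rw [norm_sq_eq A, norm_smul, Complex.norm_real, Real.norm_of_nonneg (by positivity)] at *
    rwa [← CStarRing.norm_self_mul_star, star_inner]
  rcases (sq_nonneg ‖z‖).eq_or_lt with h0 | h0
  · rw [← h0]; positivity
  · exact le_of_mul_le_mul_right h₇ h0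

theorem tendsto_cfc_cutoff (hX : GeomBounded X) (hg : IsGenerating A X) (x : H) :
    Tendsto (fun n => (cfc (cutoff n) (gramSelf (A := A) hX)).1 x) atTop (𝓝 x) := by
  set c : ℕ → H →L[ℂ] H := fun n => (cfc (cutoff n) (gramSelf (A := A) hX)).1 with hc
  have hc1 : ∀ n, ‖c n‖ ≤ 1 := fun n => norm_cfc_cutoff_le (p := gramSelf (A := A) hX) n
  have hspan : ∀ y ∈ Submodule.span ℂ {y : H | ∃ a : A, ∃ i, y = a • X i},
      Tendsto (fun n => c n y) atTop (𝓝 y) := by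
    intro y hy
    induction hy using Submodule.span_induction with
    | zero => simp
    | add y z _ _ hy hz => simpa using hy.add hz
    | smul r y _ hy => simpa using hy.const_smul r
    | mem y hy =>
      obtain ⟨a, i, rfl⟩ := hy
      have h : Tendsto (fun n => c n (X i)) atTop (𝓝 (X i)) := by
        rw [tendsto_iff_norm_sub_tendsto_zero]
        have h0 : Tendsto (fun n : ℕ => √(1 / (n : ℝ))) atTop (𝓝 0) := by
          simpa [Function.comp_def] using (Real.continuous_sqrt.tendsto 0).comp tendsto_one_div_atTop_nhds_zero_nat
        refine squeeze_zero' (Eventually.of_forall fun n => norm_nonneg _)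
          ((eventually_gt_atTop 0).mono fun n hn => ?_) h0
        rw [norm_sub_rev]
        exact Real.le_sqrt_of_sq_le (norm_sub_cfc_cutoff_sq_le hX hn i)
      have := ((algSMulCLM A H a).continuous.tendsto _).comp h
      simpa [Function.comp_def, hc, (isAdjoint_cfc _ _).map_alg_smul] using this
  rw [Metric.tendsto_atTop]
  intro ε hε
  obtain ⟨y, hy, hxy⟩ := Metric.dense_iff.1 hg x (ε / 3) (by positivity)
  obtain ⟨N, hN⟩ := Metric.tendsto_atTop.1 (hspan y hxy) (ε / 3) (by positivity)
  refine ⟨N, fun n hn => ?_⟩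
  have h₁ : dist (c n x) (c n y) ≤ dist x y := by
    rw [dist_eq_norm, dist_eq_norm, ← map_sub]
    exact (c n).le_of_opNorm_le (hc1 n) _ |>.trans_eq (one_mul _)
  have h₂ := hN n hn
  have h₃ : dist y x < ε / 3 := hy
  have h₄ := dist_triangle4 (c n x) (c n y) y x
  rw [dist_comm x y] at h₁
  linarith

/-- Partial sums of the lift. -/
def liftSum (hX : GeomBounded X) (hY : GeomBounded Y) (s : Finset ℕ) : H →L[ℂ] E :=
  ∑ k ∈ s, (cfc (cutoffRoot k) (gramSelf (A := A) hY)).1 ∘L gramOp A X Y ∘L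
    (cfc (cutoffRoot k) (gramSelf (A := A) hX)).1

theorem isAdjoint_liftSum (hX : GeomBounded X) (hY : GeomBounded Y) (s : Finset ℕ) :
    IsAdjoint A (liftSum (A := A) hX hY s) (liftSum (A := A) hY hX s) :=
  .sum s fun _ _ => (isAdjoint_cfc _ _).comp ((isAdjoint_gramOp hX hY).comp (isAdjoint_cfc _ _))

theorem sum_inner_gramOp_cutoffRoot (hX : GeomBounded X) {m n : ℕ} (hmn : m ≤ n) (x : H) :
    ∑ k ∈ Finset.Ico m n, inner A
      (gramOp A X X ((cfc (cutoffRoot k) (gramSelf (A := A) hX)).1 x))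
      ((cfc (cutoffRoot k) (gramSelf (A := A) hX)).1 x) =
    inner A ((cfc (cutoff n) (gramSelf (A := A) hX) - cfc (cutoff m) (gramSelf (A := A) hX)).1 x)
      x := by
  have h : ∀ k, inner A (gramOp A X X ((cfc (cutoffRoot k) (gramSelf (A := A) hX)).1 x))
      ((cfc (cutoffRoot k) (gramSelf (A := A) hX)).1 x) =
      inner A ((cfc (cutoff (k + 1)) (gramSelf (A := A) hX)).1 x -
        (cfc (cutoff k) (gramSelf (A := A) hX)).1 x) x := fun k => by
    rw [← isAdjoint_cfc]
    have := cfc_cutoffRoot_mul (isSelfAdjoint_gramSelf (A := A) hX) k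
    exact congrArg (fun T : adjointable A H => inner A (T.1 x) x) this
  simp only [h, ← CStarModule.inner_sum_left]
  rw [Finset.sum_Ico_sub (fun k => (cfc (cutoff k) (gramSelf (A := A) hX)).1 x) hmn]
  rfl

/-- The Gram inequality is tested against y, the value itself. The sums over k telescope, so ‖y‖⁴ is
at most ‖⟪Δx, x⟫‖ ‖⟪Δ'y, y⟫‖ with Δ and Δ' of norm at most 1, and ‖y‖² cancels. Taking m = 0 gives
contractivity; general m gives the Cauchy property. -/
theorem norm_liftSum_Ico_sq_le (hX : GeomBounded X) (hY : GeomBounded Y) {m n : ℕ} (hmn : m ≤ n)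
    (x : H) : ‖liftSum (A := A) hX hY (Finset.Ico m n) x‖ ^ 2 ≤
      ‖(cfc (cutoff n) (gramSelf (A := A) hX) - cfc (cutoff m) (gramSelf (A := A) hX)).1 x‖ *
        ‖x‖ := by
  set y := liftSum (A := A) hX hY (Finset.Ico m n) x with hy
  have h := norm_sum_inner_gramOp_sq_le (A := A) hX hY (Finset.Ico m n)
    (fun k => (cfc (cutoffRoot k) (gramSelf (A := A) hX)).1 x)
    (fun k => (cfc (cutoffRoot k) (gramSelf (A := A) hY)).1 y)
  rw [sum_inner_gramOp_cutoffRoot hX hmn, sum_inner_gramOp_cutoffRoot hY hmn] at h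
  have h₁ : ∑ k ∈ Finset.Ico m n, inner A
      (gramOp A X Y ((cfc (cutoffRoot k) (gramSelf (A := A) hX)).1 x))
      ((cfc (cutoffRoot k) (gramSelf (A := A) hY)).1 y) = inner A y y := by
    change _ = inner A (liftSum (A := A) hX hY (Finset.Ico m n) x) y
    rw [liftSum, _root_.sum_apply, CStarModule.inner_sum_left]
    refine Finset.sum_congr rfl fun k _ => ?_
    rw [← isAdjoint_cfc]
    rfl
  rw [h₁, ← norm_sq_eq A] at h
  set c := (cfc (cutoff n) (gramSelf (A := A) hX) - cfc (cutoff m) (gramSelf (A := A) hX)).1 x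
  have h₂ : ‖(cfc (cutoff n) (gramSelf (A := A) hY) -
      cfc (cutoff m) (gramSelf (A := A) hY)).1 y‖ ≤ ‖y‖ :=
    (ContinuousLinearMap.le_of_opNorm_le _ (norm_cfc_cutoff_sub_le (p := gramSelf (A := A) hY) hmn)
      y).trans_eq (one_mul _)
  have h₃ : (‖y‖ ^ 2) ^ 2 ≤ ‖c‖ * ‖x‖ * (‖y‖ * ‖y‖) := h.trans (by
    gcongr
    · exact norm_inner_le H
    · exact (norm_inner_le E).trans (by gcongr))
  rcases (sq_nonneg ‖y‖).eq_or_lt with h0 | h0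
  · rw [← h0]; positivity
  · refine le_of_mul_le_mul_right ?_ h0
    nlinarith

theorem norm_liftSum_range_le (hX : GeomBounded X) (hY : GeomBounded Y) (n : ℕ) (x : H) :
    ‖liftSum (A := A) hX hY (Finset.range n) x‖ ≤ ‖x‖ := by
  have h := norm_liftSum_Ico_sq_le (A := A) hX hY n.zero_le x
  rw [← Finset.range_eq_Ico] at h
  refine le_of_sq_le_sq (h.trans ?_) (norm_nonneg x)
  rw [sq]
  gcongr
  exact (ContinuousLinearMap.le_of_opNorm_le _
    (norm_cfc_cutoff_sub_le (p := gramSelf (A := A) hX) n.zero_le) x).trans_eq (one_mul _)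

theorem cauchySeq_liftSum (hX : GeomBounded X) (hY : GeomBounded Y) (hg : IsGenerating A X)
    (x : H) : CauchySeq fun n => liftSum (A := A) hX hY (Finset.range n) x := by
  have hcau := (tendsto_cfc_cutoff hX hg x).cauchySeq
  have key : ∀ m n, m ≤ n → dist (liftSum (A := A) hX hY (Finset.range m) x)
      (liftSum (A := A) hX hY (Finset.range n) x) ^ 2 ≤
      dist ((cfc (cutoff m) (gramSelf (A := A) hX)).1 x)
        ((cfc (cutoff n) (gramSelf (A := A) hX)).1 x) * ‖x‖ := fun m n hmn => by
    have h := norm_liftSum_Ico_sq_le (A := A) hX hY hmn x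
    rw [liftSum, Finset.sum_Ico_eq_sub _ hmn] at h
    rw [dist_comm, dist_comm (((cfc (cutoff m) (gramSelf (A := A) hX)).1 x)), dist_eq_norm,
      dist_eq_norm]
    exact h
  refine Metric.cauchySeq_iff'.2 fun ε hε => ?_
  -- The estimate bounds the squared distance by ‖x‖ times this one; the 1 allows x = 0.
  obtain ⟨N, hN⟩ := Metric.cauchySeq_iff'.1 hcau (ε ^ 2 / (‖x‖ + 1)) (by positivity)
  refine ⟨N, fun n hn => ?_⟩
  have h₁ := key N n hn
  have h₂ := hN n hn
  rw [dist_comm, lt_div_iff₀ (by positivity)] at h₂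
  rw [dist_comm]
  refine lt_of_pow_lt_pow_left₀ 2 hε.le (h₁.trans_lt (lt_of_le_of_lt ?_ h₂))
  gcongr
  linarith

theorem exists_tendsto_liftSum (hX : GeomBounded X) (hY : GeomBounded Y) (hg : IsGenerating A X) :
    ∃ ψ : H →L[ℂ] E,
      ∀ x, Tendsto (fun n => liftSum (A := A) hX hY (Finset.range n) x) atTop (𝓝 (ψ x)) := by
  choose f hf using fun x => cauchySeq_tendsto_of_complete (cauchySeq_liftSum hX hY hg x)
  -- The convergence is only pointwise; boundedness of the limit is Banach–Steinhaus.
  exact ⟨continuousLinearMapOfTendsto _ (tendsto_pi_nhds.2 hf), hf⟩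

end Strict

end

section

variable {A : Type*} [NonUnitalCStarAlgebra A] [PartialOrder A] [StarOrderedRing A]
  {E : Type*} [NormedAddCommGroup E] [NormedSpace ℂ E] [SMul A E] [CStarModule A E]
  {H : Type*} [NormedAddCommGroup H] [NormedSpace ℂ H] [SMul A H] [CStarModule A H]

/-! ### Lifting an isomorphism of quotients to an adjointable contraction -/

theorem IsCountablyGenerated.exists_isGenerating (h : IsCountablyGenerated A H) :
    ∃ X : ℕ → H, IsGenerating A X := by
  obtain ⟨s, hs, hd⟩ := h
  -- Adding 0 makes the set nonempty, hence the range of a sequence.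
  obtain ⟨X, hX⟩ := (hs.insert 0).exists_eq_range (Set.insert_nonempty 0 s)
  refine ⟨X, hd.mono (Submodule.span_mono ?_)⟩
  rintro _ ⟨a, x, hx, rfl⟩
  obtain ⟨i, rfl⟩ : x ∈ Set.range X := hX ▸ Set.mem_insert_of_mem 0 hx
  exact ⟨a, i, rfl⟩

theorem IsGenerating.of_smul {X X' : ℕ → H} (h : IsGenerating A X)
    (hX : ∀ i, ∃ c : ℂ, ∃ j, X i = c • X' j) : IsGenerating A X' := by
  refine Dense.mono (Submodule.span_le.2 ?_) h
  rintro _ ⟨a, i, rfl⟩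
  obtain ⟨c, j, hc⟩ := hX i
  rw [hc, alg_smul_complex_smul]
  exact Submodule.smul_mem _ _ (Submodule.subset_span ⟨a, j, rfl⟩)

variable {I : TwoSidedIdeal A} [IsClosed (I : Set A)]

/-- Generators of H with partners in E are interleaved with generators of E with partners in H, so
both sequences generate. -/
theorem Iso.exists_generating_rel (hH : IsCountablyGenerated A H) (hE : IsCountablyGenerated A E)
    (φ : Iso I.ringCon.Quotient (H ⧸ idealSubmodule H I) (E ⧸ idealSubmodule E I)) :
    ∃ (X : ℕ → H) (Y : ℕ → E), GeomBounded X ∧ GeomBounded Y ∧ IsGenerating A X ∧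
      IsGenerating A Y ∧ ∀ i, φ.Rel (X i) (Y i) := by
  obtain ⟨U, hU⟩ := hH.exists_isGenerating
  obtain ⟨V, hV⟩ := hE.exists_isGenerating
  choose U' hU' using fun i => Iso.Rel.exists_right φ (U i)
  choose V' hV' using fun i => Iso.Rel.exists_left φ (V i)
  let σ : ℕ ≃ ℕ ⊕ ℕ := Equiv.natSumNatEquivNat.symm
  let x : ℕ → H := fun n => Sum.elim U V' (σ n)
  let y : ℕ → E := fun n => Sum.elim U' V (σ n)
  have hxy : ∀ n, φ.Rel (x n) (y n) := fun n => by
    simp only [x, y]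
    cases σ n with
    | inl i => exact hU' i
    | inr i => exact hV' i
  -- One scalar for both vectors keeps them related; the denominator dominates both norms and is
  -- nonzero.
  let r : ℕ → ℝ := fun n => (1 / 2 : ℝ) ^ n / (1 + ‖x n‖ + ‖y n‖)
  have hr : ∀ n, 0 < r n := fun n => by positivity
  have hrc : ∀ n, (r n : ℂ) ≠ 0 := fun n => by exact_mod_cast (hr n).ne'
  have hbound : ∀ n (t : ℝ), t ≤ 1 + ‖x n‖ + ‖y n‖ → ‖(r n : ℂ)‖ * t ≤ (1 / 2 : ℝ) ^ n :=
    fun n t ht => by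
      rw [Complex.norm_real, Real.norm_of_nonneg (hr n).le, div_mul_eq_mul_div]
      refine div_le_of_le_mul₀ (by positivity) (by positivity) ?_
      gcongr
  refine ⟨fun n => (r n : ℂ) • x n, fun n => (r n : ℂ) • y n, fun n => ?_, fun n => ?_,
    hU.of_smul fun i => ⟨(r (σ.symm (.inl i)) : ℂ)⁻¹, σ.symm (.inl i), ?_⟩,
    hV.of_smul fun i => ⟨(r (σ.symm (.inr i)) : ℂ)⁻¹, σ.symm (.inr i), ?_⟩,
    fun n => (hxy n).smul _⟩
  · rw [norm_smul]
    exact hbound n _ (by linarith [norm_nonneg (y n)])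
  · rw [norm_smul]
    exact hbound n _ (by linarith [norm_nonneg (x n)])
  · rw [inv_smul_smul₀ (hrc _)]
    simp [x]
  · rw [inv_smul_smul₀ (hrc _)]
    simp [y]

variable [CompleteSpace H] [CompleteSpace E]

/-- The k-th summand is related to r_k(p) p r_k(p) x = (c_{k+1}(p) - c_k(p)) x, and these telescope
from c_0 = 0. -/
theorem Iso.rel_liftSum
    {φ : Iso I.ringCon.Quotient (H ⧸ idealSubmodule H I) (E ⧸ idealSubmodule E I)}
    {X : ℕ → H} {Y : ℕ → E} (hX : GeomBounded X) (hY : GeomBounded Y)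
    (h : ∀ i, φ.Rel (X i) (Y i)) (n : ℕ) (x : H) :
    φ.Rel ((cfc (cutoff n) (gramSelf (A := A) hX)).1 x)
      (liftSum (A := A) hX hY (Finset.range n) x) := by
  have hk : ∀ k, φ.Rel ((cfc (cutoff (k + 1)) (gramSelf (A := A) hX)).1 x -
      (cfc (cutoff k) (gramSelf (A := A) hX)).1 x)
      (((cfc (cutoffRoot k) (gramSelf (A := A) hY)).1 ∘L gramOp A X Y ∘L
        (cfc (cutoffRoot k) (gramSelf (A := A) hX)).1) x) := fun k => by
    have h₁ := cfc_prod_mem φ.intertwined φ.isClosed_intertwined (continuous_cutoffRoot k)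
      (isSelfAdjoint_gramSelf hX) (isSelfAdjoint_gramSelf hY) (Iso.gramSelf_mem_intertwined hX hY h)
      _ _ (Iso.Rel.gramOp_self hX hY h ((cfc (cutoffRoot k) (gramSelf (A := A) hX)).1 x))
    change φ.Rel ((cfc (cutoff (k + 1)) (gramSelf (A := A) hX) -
      cfc (cutoff k) (gramSelf (A := A) hX)).1 x) _
    rw [← cfc_cutoffRoot_mul (isSelfAdjoint_gramSelf (A := A) hX) k]
    exact h₁
  have h₂ := Iso.Rel.sum (Finset.range n) hk
  rw [Finset.sum_range_sub (fun k => (cfc (cutoff k) (gramSelf (A := A) hX)).1 x),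
    cfc_cutoff_zero] at h₂
  rw [liftSum, _root_.sum_apply]
  simpa using h₂

/-- An isomorphism of quotients of countably generated Hilbert modules lifts to an adjointable
contraction. -/
theorem Iso.exists_contraction_lift (hH : IsCountablyGenerated A H)
    (hE : IsCountablyGenerated A E)
    (φ : Iso I.ringCon.Quotient (H ⧸ idealSubmodule H I) (E ⧸ idealSubmodule E I)) :
    ∃ (ψ : H →L[ℂ] E) (ψ' : E →L[ℂ] H), IsAdjoint A ψ ψ' ∧ ‖ψ‖ ≤ 1 ∧ ∀ x, φ.Rel x (ψ x) := by
  obtain ⟨X, Y, hX, hY, hgX, hgY, h⟩ := φ.exists_generating_rel hH hE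
  obtain ⟨ψ, hψ⟩ := exists_tendsto_liftSum hX hY hgX
  obtain ⟨ψ', hψ'⟩ := exists_tendsto_liftSum hY hX hgY
  refine ⟨ψ, ψ', .of_tendsto (fun n => isAdjoint_liftSum hX hY (Finset.range n)) hψ hψ',
    ψ.opNorm_le_bound zero_le_one fun x => ?_, fun x => ?_⟩
  · rw [one_mul]
    exact le_of_tendsto' (hψ x).norm fun n => norm_liftSum_range_le hX hY n x
  · exact .of_tendsto (fun n => Iso.rel_liftSum hX hY h n x) (tendsto_cfc_cutoff hX hgX x) (hψ x)

end

section

variable {A : Type*} [NonUnitalCStarAlgebra A] [PartialOrder A] [StarOrderedRing A]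
  {E : Type*} [NormedAddCommGroup E] [NormedSpace ℂ E] [SMul A E] [CStarModule A E]
  {H : Type*} [NormedAddCommGroup H] [NormedSpace ℂ H] [SMul A H] [CStarModule A H]

/-! ### Unitary block matrices -/

section Block

variable {E₁ : Type*} [NormedAddCommGroup E₁] [NormedSpace ℂ E₁] [SMul A E₁] [CStarModule A E₁]
  {H₁ : Type*} [NormedAddCommGroup H₁] [NormedSpace ℂ H₁] [SMul A H₁] [CStarModule A H₁]

variable (A) in
/-- The operator `(x, y) ↦ (a x + b y, c x + d y)`. -/
def blockMap (a : H →ₗ[ℂ] E) (b : E₁ →ₗ[ℂ] E) (c : H →ₗ[ℂ] H₁) (d : E₁ →ₗ[ℂ] H₁) :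
    C⋆ᵐᵒᵈ(A, H × E₁) →ₗ[ℂ] C⋆ᵐᵒᵈ(A, E × H₁) where
  toFun z := pair A (a z.1 + b z.2) (c z.1 + d z.2)
  map_add' z w := (equiv A (E × H₁)).injective <| Prod.ext
    (by simp [pair, add_add_add_comm]) (by simp [pair, add_add_add_comm])
  map_smul' r z := (equiv A (E × H₁)).injective <| Prod.ext (by simp [pair]) (by simp [pair])

/-- A block matrix with adjointable entries whose adjoint is its inverse is an isomorphism. -/
def blockIso (a : H →ₗ[ℂ] E) (b : E₁ →ₗ[ℂ] E) (c : H →ₗ[ℂ] H₁) (d : E₁ →ₗ[ℂ] H₁)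
    (a' : E →ₗ[ℂ] H) (b' : E →ₗ[ℂ] E₁) (c' : H₁ →ₗ[ℂ] H) (d' : H₁ →ₗ[ℂ] E₁)
    (ha : ∀ x y, inner A (a x) y = inner A x (a' y))
    (hb : ∀ x y, inner A (b x) y = inner A x (b' y))
    (hc : ∀ x y, inner A (c x) y = inner A x (c' y))
    (hd : ∀ x y, inner A (d x) y = inner A x (d' y))
    (h₁ : ∀ x y, a' (a x + b y) + c' (c x + d y) = x)
    (h₂ : ∀ x y, b' (a x + b y) + d' (c x + d y) = y)
    (h₃ : ∀ x y, a (a' x + c' y) + b (b' x + d' y) = x)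
    (h₄ : ∀ x y, c (a' x + c' y) + d (b' x + d' y) = y) :
    Iso A C⋆ᵐᵒᵈ(A, H × E₁) C⋆ᵐᵒᵈ(A, E × H₁) :=
  have hT : ∀ z w, inner A (blockMap A a b c d z) w = inner A z (blockMap A a' c' b' d' w) :=
    fun z w => by
      simp only [blockMap, pair, LinearMap.coe_mk, AddHom.coe_mk, prod_inner, equiv_symm_fst,
        equiv_symm_snd, CStarModule.inner_add_left, CStarModule.inner_add_right, ha, hb, hc, hd]
      abel
  have hl : ∀ z, blockMap A a' c' b' d' (blockMap A a b c d z) = z := fun z =>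
    (equiv A (H × E₁)).injective <| Prod.ext (h₁ z.1 z.2) (h₂ z.1 z.2)
  have hr : ∀ z, blockMap A a b c d (blockMap A a' c' b' d' z) = z := fun z =>
    (equiv A (E × H₁)).injective <| Prod.ext (h₃ z.1 z.2) (h₄ z.1 z.2)
  -- The entries are only assumed ℂ-linear; A-linearity follows by testing against the image of the
  -- map, which is everything.
  have hs : ∀ (r : A) z, blockMap A a b c d (r • z) = r • blockMap A a b c d z := fun r z =>
    ext_inner (A := A) fun w => by
      obtain ⟨v, rfl⟩ : ∃ v, blockMap A a b c d v = w := ⟨_, hr w⟩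
      rw [inner_op_smul_right, hT, hT, hl, hl, inner_op_smul_right]
  { toLinearEquiv := LinearEquiv.ofLinearMap (blockMap A a b c d) (blockMap A a' c' b' d')
      (LinearMap.ext hr) (LinearMap.ext hl)
    map_alg_smul' := hs
    inner_map_map' := fun z w => (hT z _).trans (congrArg (inner A z) (hl w)) }

end Block

/-! ### The square roots `√(1 - ψ⋆ψ)` and `√(1 - ψψ⋆)` -/

section Sqrt

variable [CompleteSpace H] [CompleteSpace E] {ψ : H →L[ℂ] E} {ψ' : E →L[ℂ] H}

/-- The adjointable operator `1 - ψ⋆ψ`. -/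
def IsAdjoint.defect (h : IsAdjoint A ψ ψ') : adjointable A H :=
  ⟨ContinuousLinearMap.id ℂ H - ψ' ∘L ψ, _, IsAdjoint.id.sub (h.symm.comp h)⟩

theorem IsAdjoint.isSelfAdjoint_defect (h : IsAdjoint A ψ ψ') : IsSelfAdjoint h.defect :=
  adjointable.isSelfAdjoint_iff.2 (IsAdjoint.id.sub (h.symm.comp h))

/-- The self-adjoint element ψ⋆ψ has norm at most 1, so it is at most 1 in the spectral order. -/
theorem IsAdjoint.defect_nonneg (h : IsAdjoint A ψ ψ') (hψ : ‖ψ‖ ≤ 1) : 0 ≤ h.defect := by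
  have hs : IsSelfAdjoint (1 - h.defect) := (IsSelfAdjoint.one _).sub h.isSelfAdjoint_defect
  have hn : ‖1 - h.defect‖ ≤ 1 := by
    have : (1 - h.defect).1 = ψ' ∘L ψ := sub_sub_cancel _ _
    change ‖(1 - h.defect).1‖ ≤ 1
    rw [this]
    refine (ContinuousLinearMap.opNorm_comp_le _ _).trans ?_
    rw [← h.norm_eq]
    exact mul_le_one₀ hψ (norm_nonneg _) hψ
  have h₁ := hs.le_algebraMap_norm_self.trans (algebraMap_mono (adjointable A H) hn)
  rwa [map_one, sub_le_self_iff] at h₁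

theorem sqrt_mul_sqrt {B : Type*} [CStarAlgebra B] [PartialOrder B] [StarOrderedRing B] {b : B}
    (hb : 0 ≤ b) : cfc Real.sqrt b * cfc Real.sqrt b = b := by
  rw [← cfc_mul Real.sqrt Real.sqrt b Real.continuous_sqrt.continuousOn
    Real.continuous_sqrt.continuousOn]
  conv_rhs => rw [← cfc_id' ℝ b]
  exact cfc_congr fun t ht => Real.mul_self_sqrt (spectrum_nonneg_of_nonneg hb ht)

theorem isPositiveSqrt_cfc_sqrt {b : adjointable A H} (hb : 0 ≤ b) :
    IsPositiveSqrt A (cfc Real.sqrt b : adjointable A H).1 b.1 :=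
  ⟨isAdjoint_cfc _ _, adjointable.inner_nonneg (cfc_nonneg fun t _ => Real.sqrt_nonneg t),
    congrArg Subtype.val (sqrt_mul_sqrt hb)⟩

/-- The pairs of operators on `H` and `E` intertwined by `ψ` and by its adjoint. -/
def IsAdjoint.intertwined (h : IsAdjoint A ψ ψ') :
    StarSubalgebra ℂ (adjointable A H × adjointable A E) where
  carrier := {T | (∀ x, ψ (T.1.1 x) = T.2.1 (ψ x)) ∧ ∀ y, ψ' (T.2.1 y) = T.1.1 (ψ' y)}
  mul_mem' {T T'} hT hT' :=
    ⟨fun x => (hT.1 (T'.1.1 x)).trans (congrArg T.2.1 (hT'.1 x)),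
      fun y => (hT.2 (T'.2.1 y)).trans (congrArg T.1.1 (hT'.2 y))⟩
  add_mem' {T T'} hT hT' :=
    ⟨fun x => (map_add ψ _ _).trans (congrArg₂ (· + ·) (hT.1 x) (hT'.1 x)),
      fun y => (map_add ψ' _ _).trans (congrArg₂ (· + ·) (hT.2 y) (hT'.2 y))⟩
  algebraMap_mem' c := ⟨map_smul ψ c, map_smul ψ' c⟩
  -- Taking adjoints exchanges the two conditions, which is why both are imposed.
  star_mem' {T} hT := by
    have h₁ := adjointable.isAdjoint_star T.1
    have h₂ := adjointable.isAdjoint_star T.2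
    refine ⟨fun x => ext_inner (A := A) fun y => ?_, fun y => ext_inner (A := A) fun x => ?_⟩
    · exact ((h.symm y _).symm.trans ((h₁ (ψ' y) x).symm.trans
        ((congrArg (fun w => inner A w x) (hT.2 y)).symm.trans (h.symm _ x)))).trans (h₂ y (ψ x))
    · exact ((h x _).symm.trans ((h₂ (ψ x) y).symm.trans
        ((congrArg (fun w => inner A w y) (hT.1 x)).symm.trans (h _ y)))).trans (h₁ x (ψ' y))

theorem IsAdjoint.isClosed_intertwined (h : IsAdjoint A ψ ψ') :
    IsClosed (h.intertwined : Set (adjointable A H × adjointable A E)) := by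
  have hH : ∀ x, Continuous fun T : adjointable A H × adjointable A E => T.1.1 x := fun x =>
    (ContinuousLinearMap.apply ℂ H x).continuous.comp (continuous_subtype_val.comp continuous_fst)
  have hE : ∀ y, Continuous fun T : adjointable A H × adjointable A E => T.2.1 y := fun y =>
    (ContinuousLinearMap.apply ℂ E y).continuous.comp (continuous_subtype_val.comp continuous_snd)
  refine IsClosed.inter
    (s₁ := {T : adjointable A H × adjointable A E | ∀ x, ψ (T.1.1 x) = T.2.1 (ψ x)})
    (s₂ := {T : adjointable A H × adjointable A E | ∀ y, ψ' (T.2.1 y) = T.1.1 (ψ' y)}) ?_ ?_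
  · simp only [Set.ofPred_forall]
    exact isClosed_iInter fun x => isClosed_eq (ψ.continuous.comp (hH x)) (hE _)
  · simp only [Set.ofPred_forall]
    exact isClosed_iInter fun y => isClosed_eq (ψ'.continuous.comp (hE y)) (hH _)

/-- The identity ψ(1 - ψ⋆ψ) = (1 - ψψ⋆)ψ and its adjoint pass to square roots by functional
calculus. This cancels the off-diagonal entries of U⋆U and UU⋆. -/
theorem IsAdjoint.sqrt_defect_mem_intertwined (h : IsAdjoint A ψ ψ') :
    (cfc Real.sqrt h.defect, cfc Real.sqrt h.symm.defect) ∈ h.intertwined :=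
  cfc_prod_mem _ h.isClosed_intertwined Real.continuous_sqrt h.isSelfAdjoint_defect
    h.symm.isSelfAdjoint_defect ⟨fun _ => map_sub ψ _ _, fun _ => map_sub ψ' _ _⟩

end Sqrt

/-! ### Lifts and the submodules HI and EI -/

section Lift

variable {I : TwoSidedIdeal A} [IsClosed (I : Set A)]
  {φ : Iso I.ringCon.Quotient (H ⧸ idealSubmodule H I) (E ⧸ idealSubmodule E I)}
  {ψ : H →L[ℂ] E} {ψ' : E →L[ℂ] H}

/-- For x' related to y', ⟪y, y'⟫ - ⟪ψ' y, x'⟫ = ⟪y, y' - ψ x'⟫, and y' - ψ x' lies in EI. -/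
theorem Iso.Rel.adjoint (h : IsAdjoint A ψ ψ') (hψ : ∀ x, φ.Rel x (ψ x)) (y : E) :
    φ.Rel (ψ' y) y :=
  .of_inner fun x' y' h' => by
    rw [h.symm, ← CStarModule.inner_sub_right]
    refine inner_right_mem I y ((Submodule.Quotient.eq _).1 ?_)
    exact Eq.trans h' (hψ x').symm

theorem IsAdjoint.mapsTo_idealSubmodule (h : IsAdjoint A ψ ψ') {x : H}
    (hx : x ∈ idealSubmodule H I) : ψ x ∈ idealSubmodule E I :=
  map_mem_of_mem_idealSubmodule ψ (idealSubmodule E I).toAddSubgroup (isClosed_idealSubmodule I)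
    (fun a ha x => by
      rw [h.map_alg_smul]
      exact smul_mem_idealSubmodule ha _) hx

/-- ⟪Rx, Rx⟫ = ⟪x, R²x⟫ = ⟪x, x⟫ - ⟪ψx, ψx⟫. -/
theorem IsPositiveSqrt.apply_mem_idealSubmodule (h : IsAdjoint A ψ ψ') {R : H →L[ℂ] H}
    (hR : IsPositiveSqrt A R (ContinuousLinearMap.id ℂ H - ψ' ∘L ψ)) {x : H}
    (hx : inner A (ψ x) (ψ x) - inner A x x ∈ I) : R x ∈ idealSubmodule H I := by
  refine mem_idealSubmodule_of_inner_self_mem I ?_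
  have h₁ : R (R x) = x - ψ' (ψ x) := congrArg (fun T : H →L[ℂ] H => T x) hR.2.2
  rw [hR.1, h₁, CStarModule.inner_sub_right, ← h]
  simpa using I.neg_mem hx

end Lift

end

end HilbertModule

end

theorem mainTheorem5 {A : Type*} [NonUnitalCStarAlgebra A] [PartialOrder A] [StarOrderedRing A]
    (I : TwoSidedIdeal A) [IsClosed (I : Set A)]
    {H : Type*} [NormedAddCommGroup H] [NormedSpace ℂ H] [SMul A H] [CStarModule A H]
    [CompleteSpace H]
    {E : Type*} [NormedAddCommGroup E] [NormedSpace ℂ E] [SMul A E] [CStarModule A E]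
    [CompleteSpace E]
    (hH : IsCountablyGenerated A H) (hE : IsCountablyGenerated A E)
    (φ : Iso I.ringCon.Quotient (H ⧸ idealSubmodule H I) (E ⧸ idealSubmodule E I)) :
    ∃ Φ : Iso A C⋆ᵐᵒᵈ(A, H × idealSubmodule E I) C⋆ᵐᵒᵈ(A, E × idealSubmodule H I),
      -- `Φ` lifts `φ`
      (∀ (h : H) (y : idealSubmodule E I),
        (Submodule.Quotient.mk (Φ (pair A h y)).1 : E ⧸ idealSubmodule E I) =
          φ (Submodule.Quotient.mk h)) ∧
      -- `Φ` is the restriction of the unitary matrix `U` built from a contractive lift `ψ` of `φ`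
      ∃ (ψ : H →L[ℂ] E) (ψ' : E →L[ℂ] H) (R : H →L[ℂ] H) (S : E →L[ℂ] E)
        (U : Iso A C⋆ᵐᵒᵈ(A, H × E) C⋆ᵐᵒᵈ(A, E × H)),
        IsAdjoint A ψ ψ' ∧ ‖ψ‖ ≤ 1 ∧
        (∀ h : H, (Submodule.Quotient.mk (ψ h) : E ⧸ idealSubmodule E I) =
          φ (Submodule.Quotient.mk h)) ∧
        IsPositiveSqrt A R (ContinuousLinearMap.id ℂ H - ψ' ∘L ψ) ∧
        IsPositiveSqrt A S (ContinuousLinearMap.id ℂ E - ψ ∘L ψ') ∧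
        (∀ (h : H) (e : E), U (pair A h e) = pair A (ψ h - S e) (R h + ψ' e)) ∧
        (∀ (h : H) (y : idealSubmodule E I),
          (Φ (pair A h y)).1 = (U (pair A h (y : E))).1 ∧
          ((Φ (pair A h y)).2 : H) = (U (pair A h (y : E))).2) := by
  obtain ⟨ψ, ψ', hψ, hn, hrel⟩ := φ.exists_contraction_lift hH hE
  have hn' : ‖ψ'‖ ≤ 1 := hψ.norm_eq ▸ hn
  have hrel' := Iso.Rel.adjoint hψ hrel
  have hR := isPositiveSqrt_cfc_sqrt (hψ.defect_nonneg hn)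
  have hS := isPositiveSqrt_cfc_sqrt (hψ.symm.defect_nonneg hn')
  obtain ⟨hψR, hψS⟩ := hψ.sqrt_defect_mem_intertwined
  set R : H →L[ℂ] H := (cfc Real.sqrt hψ.defect).1
  set S : E →L[ℂ] E := (cfc Real.sqrt hψ.symm.defect).1
  change ∀ x, ψ (R x) = S (ψ x) at hψR
  change ∀ y, ψ' (S y) = R (ψ' y) at hψS
  change IsPositiveSqrt A R (ContinuousLinearMap.id ℂ H - ψ' ∘L ψ) at hR
  change IsPositiveSqrt A S (ContinuousLinearMap.id ℂ E - ψ ∘L ψ') at hS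
  have hRR : ∀ x, R (R x) = x - ψ' (ψ x) := fun x => congrArg (fun T : H →L[ℂ] H => T x) hR.2.2
  have hSS : ∀ y, S (S y) = y - ψ (ψ' y) := fun y => congrArg (fun T : E →L[ℂ] E => T y) hS.2.2
  have hRm : ∀ x, R x ∈ idealSubmodule H I := fun x =>
    hR.apply_mem_idealSubmodule hψ ((hrel x).inner_sub_mem (hrel x))
  have hSm : ∀ y, S y ∈ idealSubmodule E I := fun y =>
    hS.apply_mem_idealSubmodule hψ.symm <| by
      simpa using I.neg_mem ((hrel' y).inner_sub_mem (hrel' y))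
  -- These four identities are the rows of U⋆U = 1 and UU⋆ = 1.
  have hl : ∀ x y, ψ' (ψ x + -S y) + R (R x + ψ' y) = x := fun x y => by
    simp only [map_add, map_neg, hψS, hRR]
    abel
  have hl' : ∀ x y, -S (ψ x + -S y) + ψ (R x + ψ' y) = y := fun x y => by
    simp only [map_add, map_neg, hψR, hSS]
    abel
  have hr : ∀ x y, ψ (ψ' x + R y) + -S (-S x + ψ y) = x := fun x y => by
    simp only [map_add, map_neg, hψR, hSS]
    abel
  have hr' : ∀ x y, R (ψ' x + R y) + ψ' (-S x + ψ y) = y := fun x y => by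
    simp only [map_add, map_neg, hψS, hRR]
    abel
  have hSn : ∀ x y, inner A ((-S) x) y = inner A x ((-S) y) := fun x y => by
    simpa using hS.1 x y
  let U : Iso A C⋆ᵐᵒᵈ(A, H × E) C⋆ᵐᵒᵈ(A, E × H) :=
    blockIso ψ.toLinearMap (-S).toLinearMap R.toLinearMap ψ'.toLinearMap
      ψ'.toLinearMap (-S).toLinearMap R.toLinearMap ψ.toLinearMap
      hψ hSn hR.1 hψ.symm hl hl' hr hr'
  let ι := (idealSubmodule E I).subtype
  let κ := (idealSubmodule H I).subtype
  -- The blocks are those of U and U⋆, restricted to EI and HI; the identities are inherited through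
  -- the inclusions.
  let Φ : Iso A C⋆ᵐᵒᵈ(A, H × idealSubmodule E I) C⋆ᵐᵒᵈ(A, E × idealSubmodule H I) :=
    blockIso ψ.toLinearMap ((-S).toLinearMap ∘ₗ ι) (R.toLinearMap.codRestrict _ hRm)
      ((ψ'.toLinearMap ∘ₗ ι).codRestrict _ fun y => hψ.symm.mapsTo_idealSubmodule y.2)
      ψ'.toLinearMap ((-S).toLinearMap.codRestrict _ fun y => neg_mem (hSm y))
      (R.toLinearMap ∘ₗ κ)
      ((ψ.toLinearMap ∘ₗ κ).codRestrict _ fun x => hψ.mapsTo_idealSubmodule x.2)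
      hψ (fun x y => hSn x y) (fun x y => hR.1 x y) (fun x y => hψ.symm x y)
      (fun x y => hl x y) (fun x y => Subtype.ext (hl' x y))
      (fun x y => hr x y) (fun x y => Subtype.ext (hr' x y))
  refine ⟨Φ, fun h y => ?_, ψ, ψ', R, S, U, hψ, hn, hrel, hR, hS, fun h e => ?_,
    fun h y => ⟨rfl, rfl⟩⟩
  -- The first component differs from ψ h by -S y, which lies in EI.
  · refine Eq.trans ?_ (hrel h)
    refine (Submodule.Quotient.eq _).2 ?_
    change ψ h + -S y - ψ h ∈ _
    rw [add_sub_cancel_left]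
    exact neg_mem (hSm _)
  · rw [sub_eq_add_neg]
    rfl
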